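/- **The system.** A finite set of processes has voting powers in $\mathbb N$ (possibly $0$) of total $n=3f+1$; the faulty (Byzantine) processes have total voting power at most $f$, all others are correct. Time is real. Messages are signed, so a message with a correct sender can be received only after this sender has sent it; faulty processes may send anything at any time to anyone. For an instant $GST$ and a bound $\Delta>0$ the *gossip communication* property holds: if a correct process sends or receives a message $m$ at time $t$, then every correct process receives $m$ before $\max\{t,GST\}+\Delta$. Every correct process starts at some time; process steps take zero time (time does not pass while a correct process has an applicable rule or a timeout that is due), and only finitely many events happen in bounded time. There are a predicate $valid$ on values, a function $getValue()$ returning valid values, and an injective identifier $id(v)$ of values. The function $proposer(h,r)$ is weighted round-robin: for every height $h$, among any $n$ consecutive rounds every process is the proposer of a number of rounds equal to its voting power. The timeouts grow with the round: $timeoutX(r)=initTimeoutX+r\cdot timeoutDelta$ for $X\in\{Propose,Prevote,Precommit\}$, where $initTimeoutX\ge 0$ and $timeoutDelta>0$. **The algorithm (Tendermint).** The processes run consensus instances (heights) $h=0,1,\dots$, all of them or those below a given bound. A correct process $p$ keeps $h_p$, $round_p$, $step_p$, $decision_p[\cdot]$, $lockedValue_p=validValue_p=nil$, $lockedRound_p=validRound_p=-1$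 (initially) and a log of all messages sent and received. "$k$ messages" means messages from senders of aggregate voting power at least $k$; $*$ is any value; "once" means at most once per height and round. When it starts, $p$ calls $StartRound(0)$ with $h_p=0$. $StartRound(r)$ sets $round_p:=r$, $step_p:=propose$; if $p=proposer(h_p,r)$ it broadcasts $\langle PROPOSAL,h_p,r,v,validRound_p\rangle$ with $v=validValue_p$ if this is not $nil$ and $v=getValue()$ otherwise; if $p$ is not the proposer, $OnTimeoutPropose(h_p,r)$ is scheduled after $timeoutPropose(r)$. The following rules are executed atomically, in any order, when they apply (all proposals are from the proposer of their height and round): 1. On $\langle PROPOSAL,h_p,round_p,v,-1\rangle$ with $step_p=propose$: broadcast $\langle PREVOTE,h_p,round_p,id(v)\rangle$ if $valid(v)$ and ($lockedRound_p=-1$ or $lockedValue_p=v$), else $\langle PREVOTE,h_p,round_p,nil\rangle$; $step_p:=prevote$. 2. On $\langle PROPOSAL,h_p,round_p,v,vr\rangle$ and $2f+1$ $\langle PREVOTE,h_p,vr,id(v)\rangle$ with $step_p=propose$, $0\le vr<round_p$: the same with the condition $valid(v)$ and ($lockedRound_p\le vr$ or $lockedValue_p=v$). 3. On $2f+1$ $\langle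 PREVOTE,h_p,round_p,*\rangle$ with $step_p=prevote$, once: schedule $OnTimeoutPrevote(h_p,round_p)$ after $timeoutPrevote(round_p)$. 4. On $\langle PROPOSAL,h_p,round_p,v,*\rangle$ and $2f+1$ $\langle PREVOTE,h_p,round_p,id(v)\rangle$ with $valid(v)$ and $step_p\in\{prevote,precommit\}$, once: if $step_p=prevote$, set $lockedValue_p:=v$, $lockedRound_p:=round_p$, broadcast $\langle PRECOMMIT,h_p,round_p,id(v)\rangle$, $step_p:=precommit$; in any case $validValue_p:=v$, $validRound_p:=round_p$. 5. On $2f+1$ $\langle PREVOTE,h_p,round_p,nil\rangle$ with $step_p=prevote$: broadcast $\langle PRECOMMIT,h_p,round_p,nil\rangle$; $step_p:=precommit$. 6. On $2f+1$ $\langle PRECOMMIT,h_p,round_p,*\rangle$, once: schedule $OnTimeoutPrecommit(h_p,round_p)$ after $timeoutPrecommit(round_p)$. 7. On $\langle PROPOSAL,h_p,r,v,*\rangle$ and $2f+1$ $\langle PRECOMMIT,h_p,r,id(v)\rangle$ for some $r$, with $decision_p[h_p]=nil$ and $valid(v)$: $decision_p[h_p]:=v$ ($p$ decides), $h_p:=h_p+1$,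 reset the locked and valid variables, drop the messages of the finished heights from the log, and call $StartRound(0)$. 8. On $f+1$ messages of height $h_p$ and of one round $r>round_p$: $StartRound(r)$. When a timeout scheduled for $(h,r)$ expires and $(h,r)=(h_p,round_p)$: $OnTimeoutPropose$ broadcasts $\langle PREVOTE,h_p,round_p,nil\rangle$ and sets $step_p:=prevote$ if $step_p=propose$; $OnTimeoutPrevote$ broadcasts $\langle PRECOMMIT,h_p,round_p,nil\rangle$ and sets $step_p:=precommit$ if $step_p=prevote$; $OnTimeoutPrecommit$ calls $StartRound(round_p+1)$. **Lemma 7 (Termination).** In every execution, for every height $h$ that is run, all correct processes eventually decide at height $h$. Moreover they do so within bounded time after $GST$: there is a function $B:\mathbb N\to\mathbb R$, depending only on $f$, $\Delta$ and the timeout parameters, such that in every execution, for every height $h$ that is run and every time $T\ge GST$ by which all correct processes have started and reached height $h$, if no correct process has started a round of height $h$ larger than $r_0$ by time $T$, then all correct processes have decided at height $h$ by time $T+B(r_0)$. -/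

import Mathlib

namespace Tendermint

/-- Numerical parameters: the fault threshold `f` (the total voting power is `n = 3 f + 1`) and
the timeouts `timeoutX(r) = initTimeoutX + r * timeoutDelta`, which grow with the round `r`. -/
structure Params where
  f : ℕ
  initPropose : ℝ
  initPrevote : ℝ
  initPrecommit : ℝ
  timeoutDelta : ℝ
  initPropose_nonneg : 0 ≤ initPropose
  initPrevote_nonneg : 0 ≤ initPrevote
  initPrecommit_nonneg : 0 ≤ initPrecommit
  timeoutDelta_pos : 0 < timeoutDelta

namespace Params

/-- Total voting power. -/
def n (par : Params) : ℕ := 3 * par.f + 1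

def timeoutPropose (par : Params) (r : ℕ) : ℝ := par.initPropose + r * par.timeoutDelta

def timeoutPrevote (par : Params) (r : ℕ) : ℝ := par.initPrevote + r * par.timeoutDelta

def timeoutPrecommit (par : Params) (r : ℕ) : ℝ := par.initPrecommit + r * par.timeoutDelta

end Params

/-- A system of processes `P` agreeing on values `V` with value identifiers `I`. -/
structure System (par : Params) (P V I : Type*) [Fintype P] where
  /-- voting power (possibly `0`) -/
  power : P → ℕ
  power_total : ∑ p, power p = par.n
  /-- proposer of a height and a round -/
  proposer : ℕ → ℕ → P
  /-- weighted round-robin: among any `n` consecutive rounds of a height, every process is the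
  proposer of a number of rounds equal to its voting power -/
  weighted_round_robin : ∀ (h r : ℕ) (p : P),
    {i : ℕ | i < par.n ∧ proposer h (r + i) = p}.ncard = power p
  /-- the application-specific validity predicate -/
  valid : V → Prop
  /-- the external function that a proposer asks for a valid value; the answer may depend on the
  process, the height and the round -/
  getValue : P → ℕ → ℕ → V
  getValue_valid : ∀ p h r, valid (getValue p h r)
  /-- the unique identifier of a value -/
  idOf : V → I
  idOf_injective : Function.Injective idOf
  /-- The consensus instances run by the processes are those of the heights `h < heights`;
  `heights = ⊤` is the endless sequence of instances. -/
  heights : ℕ∞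

/-- Signed messages; `src` is the (authenticated) original sender. The identifier carried by a
vote is `none` for a vote for nil. -/
inductive Msg (P V I : Type*) where
  | proposal (src : P) (height round : ℕ) (v : V) (validRound : ℤ)
  | prevote (src : P) (height round : ℕ) (i : Option I)
  | precommit (src : P) (height round : ℕ) (i : Option I)

namespace Msg

variable {P V I : Type*}

def src : Msg P V I → P
  | proposal p _ _ _ _ => p
  | prevote p _ _ _ => p
  | precommit p _ _ _ => p

def height : Msg P V I → ℕ
  | proposal _ h _ _ _ => h
  | prevote _ h _ _ => h
  | precommit _ h _ _ => h

def round : Msg P V I → ℕ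
  | proposal _ _ r _ _ => r
  | prevote _ _ r _ => r
  | precommit _ _ r _ => r

end Msg

/-- The step inside a round. Its three values also name the three kinds of timeouts. -/
inductive Phase where
  | propose
  | prevote
  | precommit

/-- A scheduled call `OnTimeoutX(height, round)`, to be executed at time `deadline`. -/
structure Timer where
  kind : Phase
  height : ℕ
  round : ℕ
  deadline : ℝ

/-- Local state of a process. -/
structure LState (P V I : Type*) where
  /-- the process has executed its start event -/
  started : Bool
  height : ℕ
  round : ℕ
  step : Phase
  decision : ℕ → Option V
  lockedValue : Option V
  lockedRound : ℤ
  validValue : Option V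
  validRound : ℤ
  /-- message log: received and sent messages -/
  log : Set (Msg P V I)
  /-- history of all messages that the process has broadcast -/
  sent : Set (Msg P V I)
  /-- scheduled timeouts -/
  timers : Set Timer
  /-- the rule for `2 f + 1` arbitrary prevotes has been executed in the current round -/
  anyPrevotesDone : Bool
  /-- the rule for a proposal with `2 f + 1` prevotes for it has been executed in the current
  round -/
  polkaDone : Bool
  /-- the rule for `2 f + 1` arbitrary precommits has been executed in the current round -/
  anyPrecommitsDone : Bool

namespace LState

variable {P V I : Type*}

def initial : LState P V I where
  started := false
  height := 0
  round := 0
  step := Phase.propose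
  decision := fun _ => none
  lockedValue := none
  lockedRound := -1
  validValue := none
  validRound := -1
  log := ∅
  sent := ∅
  timers := ∅
  anyPrevotesDone := false
  polkaDone := false
  anyPrecommitsDone := false

/-- Send `m` to all; sent messages are stored in the own log. -/
def broadcast (s : LState P V I) (m : Msg P V I) : LState P V I :=
  { s with log := insert m s.log, sent := insert m s.sent }

def schedule (s : LState P V I) (tm : Timer) : LState P V I :=
  { s with timers := insert tm s.timers }

end LState

section Algorithm

variable {par : Params} {P V I : Type*} [Fintype P]

/-- Aggregate voting power of a set of processes. -/
noncomputable def System.weight (sys : System par P V I) (A : Set P) : ℕ :=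
  ∑ p, A.indicator sys.power p

/-- Processes whose prevote for `i` in the given height and round is in the log. -/
def prevotersFor (log : Set (Msg P V I)) (h r : ℕ) (i : Option I) : Set P :=
  {q | Msg.prevote q h r i ∈ log}

def prevoters (log : Set (Msg P V I)) (h r : ℕ) : Set P :=
  {q | ∃ i, Msg.prevote q h r i ∈ log}

def precommittersFor (log : Set (Msg P V I)) (h r : ℕ) (i : Option I) : Set P :=
  {q | Msg.precommit q h r i ∈ log}

def precommitters (log : Set (Msg P V I)) (h r : ℕ) : Set P :=
  {q | ∃ i, Msg.precommit q h r i ∈ log}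

/-- Senders of any logged message of the given height and round. -/
def senders (log : Set (Msg P V I)) (h r : ℕ) : Set P :=
  {q | ∃ m ∈ log, m.src = q ∧ m.height = h ∧ m.round = r}

open scoped Classical in
/-- `StartRound(r)` executed by `p` at time `now`. -/
noncomputable def startRound (sys : System par P V I) (p : P) (now : ℝ) (s : LState P V I)
    (r : ℕ) : LState P V I :=
  let s₁ : LState P V I :=
    { s with
      round := r
      step := Phase.propose
      anyPrevotesDone := false
      polkaDone := false
      anyPrecommitsDone := false }
  if sys.proposer s.height r = p then
    s₁.broadcast (Msg.proposal p s.height r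
      (s.validValue.getD (sys.getValue p s.height r)) s.validRound)
  else
    s₁.schedule ⟨Phase.propose, s.height, r, now + par.timeoutPropose r⟩

open scoped Classical in
/-- Begin the consensus instance of the current height, if it is one of those to be run. -/
noncomputable def startHeight (sys : System par P V I) (p : P) (now : ℝ) (s : LState P V I) :
    LState P V I :=
  if (s.height : ℕ∞) < sys.heights then startRound sys p now s 0 else s

/-- Broadcast a prevote in the current round and move to step prevote. -/
def castPrevote (p : P) (s : LState P V I) (i : Option I) : LState P V I :=
  { s.broadcast (Msg.prevote p s.height s.round i) with step := Phase.prevote }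

/-- Broadcast a precommit in the current round and move to step precommit. -/
def castPrecommit (p : P) (s : LState P V I) (i : Option I) : LState P V I :=
  { s.broadcast (Msg.precommit p s.height s.round i) with step := Phase.precommit }

open scoped Classical in
/-- Effect of a proposal for `v` together with `2 f + 1` prevotes for `v` in the current round. -/
noncomputable def onPolka (sys : System par P V I) (p : P) (s : LState P V I) (v : V) :
    LState P V I :=
  let s₁ : LState P V I :=
    if s.step = Phase.prevote then
      castPrecommit p { s with lockedValue := some v, lockedRound := s.round }
        (some (sys.idOf v))
    else s
  { s₁ with validValue := some v, validRound := s.round, polkaDone := true }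

/-- Effect of the decision rule: record the decision, go to the next height, reset the
variables, drop the messages of the finished instance from the log, and start round `0` of the
next height. -/
noncomputable def decide (sys : System par P V I) (p : P) (now : ℝ) (s : LState P V I) (v : V) :
    LState P V I :=
  startHeight sys p now
    { s with
      decision := Function.update s.decision s.height (some v)
      height := s.height + 1
      lockedValue := none
      lockedRound := -1
      validValue := none
      validRound := -1
      log := {m ∈ s.log | s.height + 1 ≤ m.height} }

open scoped Classical in
/-- The message-triggered upon rules of a correct process `p` at time `now`. -/
inductive Rule (sys : System par P V I) (p : P) (now : ℝ) :
    LState P V I → LState P V I → Prop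
  | newProposal (s : LState P V I) (v : V)
      (hmsg : Msg.proposal (sys.proposer s.height s.round) s.height s.round v (-1) ∈ s.log)
      (hstep : s.step = Phase.propose) :
      Rule sys p now s (castPrevote p s
        (if sys.valid v ∧ (s.lockedRound = -1 ∨ s.lockedValue = some v)
          then some (sys.idOf v) else none))
  | oldProposal (s : LState P V I) (v : V) (vr : ℕ)
      (hmsg : Msg.proposal (sys.proposer s.height s.round) s.height s.round v (vr : ℤ) ∈ s.log)
      (hquorum : 2 * par.f + 1 ≤
        sys.weight (prevotersFor s.log s.height vr (some (sys.idOf v))))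
      (hstep : s.step = Phase.propose) (hvr : vr < s.round) :
      Rule sys p now s (castPrevote p s
        (if sys.valid v ∧ (s.lockedRound ≤ (vr : ℤ) ∨ s.lockedValue = some v)
          then some (sys.idOf v) else none))
  | anyPrevotes (s : LState P V I)
      (hquorum : 2 * par.f + 1 ≤ sys.weight (prevoters s.log s.height s.round))
      (hstep : s.step = Phase.prevote) (hfirst : s.anyPrevotesDone = false) :
      Rule sys p now s
        ({ s with anyPrevotesDone := true }.schedule
          ⟨Phase.prevote, s.height, s.round, now + par.timeoutPrevote s.round⟩)
  | polka (s : LState P V I) (v : V) (vr : ℤ)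
      (hmsg : Msg.proposal (sys.proposer s.height s.round) s.height s.round v vr ∈ s.log)
      (hquorum : 2 * par.f + 1 ≤
        sys.weight (prevotersFor s.log s.height s.round (some (sys.idOf v))))
      (hvalid : sys.valid v) (hstep : s.step = Phase.prevote ∨ s.step = Phase.precommit)
      (hfirst : s.polkaDone = false) :
      Rule sys p now s (onPolka sys p s v)
  | nilPrevotes (s : LState P V I)
      (hquorum : 2 * par.f + 1 ≤ sys.weight (prevotersFor s.log s.height s.round none))
      (hstep : s.step = Phase.prevote) :
      Rule sys p now s (castPrecommit p s none)
  | anyPrecommits (s : LState P V I)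
      (hquorum : 2 * par.f + 1 ≤ sys.weight (precommitters s.log s.height s.round))
      (hfirst : s.anyPrecommitsDone = false) :
      Rule sys p now s
        ({ s with anyPrecommitsDone := true }.schedule
          ⟨Phase.precommit, s.height, s.round, now + par.timeoutPrecommit s.round⟩)
  | decision (s : LState P V I) (r : ℕ) (v : V) (vr : ℤ)
      (hmsg : Msg.proposal (sys.proposer s.height r) s.height r v vr ∈ s.log)
      (hquorum : 2 * par.f + 1 ≤
        sys.weight (precommittersFor s.log s.height r (some (sys.idOf v))))
      (hundecided : s.decision s.height = none) (hvalid : sys.valid v) :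
      Rule sys p now s (decide sys p now s v)
  | skipRound (s : LState P V I) (r : ℕ)
      (hquorum : par.f + 1 ≤ sys.weight (senders s.log s.height r)) (hr : s.round < r) :
      Rule sys p now s (startRound sys p now s r)

/-- A process takes part in the algorithm once it has started, and as long as there are
consensus instances left to run. -/
def Active (sys : System par P V I) (s : LState P V I) : Prop :=
  s.started = true ∧ (s.height : ℕ∞) < sys.heights

open scoped Classical in
/-- The handlers `OnTimeoutPropose`, `OnTimeoutPrevote`, `OnTimeoutPrecommit`; the expired timer
is removed. -/
noncomputable def onTimeout (sys : System par P V I) (p : P) (now : ℝ) (s : LState P V I)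
    (tm : Timer) : LState P V I :=
  let s₁ : LState P V I := { s with timers := s.timers \ {tm} }
  if tm.height = s.height ∧ tm.round = s.round then
    match tm.kind with
    | Phase.propose => if s.step = Phase.propose then castPrevote p s₁ none else s₁
    | Phase.prevote => if s.step = Phase.prevote then castPrecommit p s₁ none else s₁
    | Phase.precommit => startRound sys p now s₁ (s.round + 1)
  else s₁

open scoped Classical in
/-- One atomic event at time `now`. Only the states of correct processes evolve; a faulty process
acts through arbitrary messages carrying the signature of a faulty process, which may be received
by anyone at any time. A message signed by a correct process can only be received after that
process has sent it. -/
inductive Event (sys : System par P V I) (faulty : Finset P) (now : ℝ) :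
    (P → LState P V I) → (P → LState P V I) → Prop
  | idle (c : P → LState P V I) : Event sys faulty now c c
  | start (c : P → LState P V I) (p : P) (hp : p ∉ faulty) (hs : (c p).started = false) :
      Event sys faulty now c
        (Function.update c p (startHeight sys p now { c p with started := true }))
  | receive (c : P → LState P V I) (p : P) (m : Msg P V I) (hp : p ∉ faulty)
      (hm : m.src ∉ faulty → m ∈ (c m.src).sent) :
      Event sys faulty now c (Function.update c p { c p with log := insert m (c p).log })
  | rule (c : P → LState P V I) (p : P) (s' : LState P V I) (hp : p ∉ faulty)
      (hactive : Active sys (c p)) (hrule : Rule sys p now (c p) s') :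
      Event sys faulty now c (Function.update c p s')
  | timeout (c : P → LState P V I) (p : P) (tm : Timer) (hp : p ∉ faulty)
      (htm : tm ∈ (c p).timers) (hdue : tm.deadline ≤ now) :
      Event sys faulty now c (Function.update c p (onTimeout sys p now (c p) tm))

/-- A timed execution of the algorithm in the partially synchronous model with gossip
communication. The `k`-th event takes place at time `time k` and leads from the configuration
`state k` to `state (k + 1)`. -/
structure Execution (sys : System par P V I) (faulty : Finset P) (GST Δ : ℝ) where
  state : ℕ → P → LState P V I
  time : ℕ → ℝ
  state_zero : ∀ p, state 0 p = LState.initial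
  time_mono : Monotone time
  time_diverges : Filter.Tendsto time Filter.atTop Filter.atTop
  event : ∀ k, Event sys faulty (time k) (state k) (state (k + 1))
  /-- every correct process starts -/
  starts : ∀ p ∉ faulty, ∃ k, (state k p).started = true
  /-- process steps take zero time: time does not pass while a correct process has a rule to
  execute -/
  rules_urgent : ∀ k, time k < time (k + 1) → ∀ p ∉ faulty, Active sys (state (k + 1) p) →
    ¬ ∃ s', Rule sys p (time k) (state (k + 1) p) s'
  /-- scheduled timeouts are executed when they are due: time does not pass a pending deadline -/
  timers_urgent : ∀ k, time k < time (k + 1) → ∀ p ∉ faulty,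
    ∀ tm ∈ (state (k + 1) p).timers, time (k + 1) ≤ tm.deadline
  /-- gossip communication: a message that a correct process has sent or received at time `t` is
  received by every correct process before `max t GST + Δ` -/
  gossip : ∀ k, ∀ p ∉ faulty, ∀ m ∈ (state (k + 1) p).log, ∀ q ∉ faulty,
    ∃ j, time j < max (time k) GST + Δ ∧ m ∈ (state (j + 1) q).log

namespace Execution

variable {sys : System par P V I} {faulty : Finset P} {GST Δ : ℝ}

/-- By time `T`, process `p` has started and has reached height `h`. -/
def ReachedHeight (e : Execution sys faulty GST Δ) (p : P) (h : ℕ) (T : ℝ) : Prop :=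
  ∃ k, e.time k ≤ T ∧ (e.state (k + 1) p).started = true ∧ h ≤ (e.state (k + 1) p).height

/-- By time `T`, process `p` has started round `r` of height `h`. -/
def StartedRound (e : Execution sys faulty GST Δ) (p : P) (h r : ℕ) (T : ℝ) : Prop :=
  ∃ k, e.time k ≤ T ∧ (e.state (k + 1) p).started = true ∧
    (e.state (k + 1) p).height = h ∧ (e.state (k + 1) p).round = r

/-- By time `T`, process `p` has decided on a value in the consensus instance of height `h`. -/
def DecidedBy (e : Execution sys faulty GST Δ) (p : P) (h : ℕ) (T : ℝ) : Prop :=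
  ∃ k, e.time k ≤ T ∧ ∃ v, (e.state (k + 1) p).decision h = some v

end Execution

end Algorithm

end Tendermint

/-! ### Positions in the protocol and invariants of a single process. -/

namespace Tendermint

variable {par : Params} {P V I : Type*}

/-! The bound is proved by contradiction. Suppose that from a time `T` after `GST` on, all correct
processes have reached height `h` and none leaves it during a long window (`Execution.Window`).
Rules are urgent and timers are executed when due, so after all events up to a given instant no rule
is applicable and no timer is due (`not_rule_snap`, `lt_deadline`). With gossip this keeps rounds
moving: if nobody left a round, timeouts would make everybody prevote, then precommit, then pass to
the next round (`entered_succ`, `entered_of_bound`).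

Rounds are also entered almost together. The first correct process in round `r + 1` waited for its
precommit timeout after `2f + 1` precommits; these reach everybody within `Δ`, so everybody follows
within `Δ` (`all_entered`, `exists_sync`). As timeouts grow, in all late enough rounds they exceed
every communication delay that matters (`Sync`).

Two facts about such rounds decide the matter. First, if the proposer is correct and its valid round
is at least the locked round of every correct process of positive power, then its proposal collects
all their prevotes, hence all correct precommits, and a decision follows within `4 * Δ`
(`not_sync_of_proposer`). Second, if a correct process locks in a synchronous round, the messages
behind the lock reach every correct process before the next round begins, so all valid rounds become
at least that round (`valid_of_lock`, `valid_ge_of_locked`).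

Weighted round-robin then supplies a good proposer (`false_of_long`). If some correct process locks
during a first rotation of the proposers, every correct proposer of the next rotation has a large
enough valid round. If none does, all locks are frozen during that rotation, and the process with
the largest lock is a good proposer when its turn comes. Either way a decision occurs inside the
window. One decision spreads to all by gossip of the proposal and the precommits
(`height_lt_of_bound`), and induction on the height shows that every height is reached
(`exists_reached`). -/

/-- Position of a phase inside a round. -/
def Phase.num : Phase → ℕ
  | propose => 0
  | prevote => 1
  | precommit => 2

/-- The phase in which a correct process finds itself at least once it has sent a message. -/
def Msg.num : Msg P V I → ℕ
  | proposal _ _ _ _ _ => 0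
  | prevote _ _ _ _ => 1
  | precommit _ _ _ _ => 2

/-- The process has started and its position is at least `(h, r, x)` in lexicographic order. -/
def LState.Past (s : LState P V I) (h r x : ℕ) : Prop :=
  s.started = true ∧
    (h < s.height ∨ s.height = h ∧ (r < s.round ∨ s.round = r ∧ x ≤ s.step.num))

/-- The phase that a timer presupposes. -/
def Timer.num (tm : Timer) : ℕ :=
  match tm.kind with
  | Phase.propose => 0
  | Phase.prevote => 1
  | Phase.precommit => 0

/-- Only messages of height `h` are compared, because logs lose the messages of finished heights and
gossip into a log is useful only for heights still open there. -/
lemma prevotersFor_mono {L L' : Set (Msg P V I)} {h r : ℕ} {i : Option I}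
    (hL : ∀ m ∈ L, m.height = h → m ∈ L') :
    prevotersFor L h r i ⊆ prevotersFor L' h r i := fun _ hq => hL _ hq rfl

lemma prevoters_mono {L L' : Set (Msg P V I)} {h r : ℕ}
    (hL : ∀ m ∈ L, m.height = h → m ∈ L') :
    prevoters L h r ⊆ prevoters L' h r := fun _ ⟨i, hq⟩ => ⟨i, hL _ hq rfl⟩

lemma precommittersFor_mono {L L' : Set (Msg P V I)} {h r : ℕ} {i : Option I}
    (hL : ∀ m ∈ L, m.height = h → m ∈ L') :
    precommittersFor L h r i ⊆ precommittersFor L' h r i := fun _ hq => hL _ hq rfl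

lemma precommitters_mono {L L' : Set (Msg P V I)} {h r : ℕ}
    (hL : ∀ m ∈ L, m.height = h → m ∈ L') :
    precommitters L h r ⊆ precommitters L' h r := fun _ ⟨i, hq⟩ => ⟨i, hL _ hq rfl⟩

variable [Fintype P]

/-- A step of a single process that can receive the messages satisfying `rcv`. -/
inductive LocalStep (sys : System par P V I) (p : P) (now : ℝ) (rcv : Msg P V I → Prop) :
    LState P V I → LState P V I → Prop
  | idle (s : LState P V I) : LocalStep sys p now rcv s s
  | start (s : LState P V I) (hs : s.started = false) :
      LocalStep sys p now rcv s (startHeight sys p now { s with started := true })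
  | receive (s : LState P V I) (m : Msg P V I) (hm : rcv m) :
      LocalStep sys p now rcv s { s with log := insert m s.log }
  | rule (s s' : LState P V I) (hactive : Active sys s) (hrule : Rule sys p now s s') :
      LocalStep sys p now rcv s s'
  | timeout (s : LState P V I) (tm : Timer) (htm : tm ∈ s.timers) (hdue : tm.deadline ≤ now) :
      LocalStep sys p now rcv s (onTimeout sys p now s tm)

/-- The timeout of a given kind and round. -/
def Params.timeout (par : Params) : Phase → ℕ → ℝ
  | Phase.propose, r => par.timeoutPropose r
  | Phase.prevote, r => par.timeoutPrevote r
  | Phase.precommit, r => par.timeoutPrecommit r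

lemma System.weight_mono (sys : System par P V I) {A B : Set P} (h : A ⊆ B) :
    sys.weight A ≤ sys.weight B := by
  unfold System.weight
  exact Finset.sum_le_sum fun p _ =>
    Set.indicator_le_indicator_of_subset h (fun _ => Nat.zero_le _) p

/-- There is a value that the process considers valid exactly from round `0` on, and it comes
with a quorum of prevotes. -/
def ValidSpec (sys : System par P V I) (log : Set (Msg P V I)) (h r : ℕ) (vr : ℤ)
    (vv : Option V) : Prop :=
  (vr = -1 ∧ vv = none) ∨ ∃ (n : ℕ) (v : V), vr = n ∧ n < r ∧ vv = some v ∧ sys.valid v ∧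
    2 * par.f + 1 ≤ sys.weight (prevotersFor log h n (some (sys.idOf v)))

lemma ValidSpec.mono {sys : System par P V I} {L L' : Set (Msg P V I)} {h r r' : ℕ} {vr : ℤ}
    {vv : Option V} (H : ValidSpec sys L h r vr vv) (hL : ∀ m ∈ L, m.height = h → m ∈ L')
    (hr : r ≤ r') : ValidSpec sys L' h r' vr vv := by
  rcases H with H | ⟨n, v, h1, h2, h3, h4, h5⟩
  · exact Or.inl H
  · exact Or.inr ⟨n, v, h1, h2.trans_le hr, h3, h4,
      h5.trans (sys.weight_mono (prevotersFor_mono hL))⟩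

/-- Invariants of a correct process that do not refer to the flags of the current round. -/
structure BaseInv (sys : System par P V I) (p : P) (s : LState P V I) : Prop where
  decided : ∀ h, s.decision h = none ↔ s.height ≤ h
  fresh : s.started = false → s.validRound = -1
  locked_ge : -1 ≤ s.lockedRound
  locked_le : s.lockedRound ≤ s.validRound
  -- The bound `s.round + 1` admits the current round as valid round. A proposal is made before this
  -- can happen, hence the stricter bound `s.round` in `has_proposal`.
  valid_spec : ValidSpec sys s.log s.height (s.round + 1) s.validRound s.validValue
  sent_src : ∀ m ∈ s.sent, m.src = p
  sent_past : ∀ m ∈ s.sent, s.Past m.height m.round m.num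
  sent_log : ∀ m ∈ s.sent, s.height ≤ m.height → m ∈ s.log
  prevote_unique : ∀ h r i i', Msg.prevote p h r i ∈ s.sent → Msg.prevote p h r i' ∈ s.sent →
    i = i'
  proposal_unique : ∀ h r v vr v' vr', Msg.proposal p h r v vr ∈ s.sent →
    Msg.proposal p h r v' vr' ∈ s.sent → v = v' ∧ vr = vr'
  timer_past : ∀ tm ∈ s.timers, s.Past tm.height tm.round tm.num

/-- Invariants of a correct process that takes part in the algorithm. -/
structure RunInv (sys : System par P V I) (p : P) (s : LState P V I) : Prop where
  has_prevote : s.step ≠ Phase.propose → ∃ i, Msg.prevote p s.height s.round i ∈ s.sent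
  has_precommit : s.step = Phase.precommit → ∃ i, Msg.precommit p s.height s.round i ∈ s.sent
  -- Here `vv` is the valid value at the moment of proposing. If it is not `none`, it is the
  -- proposed value, and its round and quorum are those that the rule for old proposals asks for.
  has_proposal : sys.proposer s.height s.round = p →
    ∃ v vr vv, Msg.proposal p s.height s.round v vr ∈ s.sent ∧ sys.valid v ∧
      (vv = none ∨ vv = some v) ∧ ValidSpec sys s.log s.height s.round vr vv
  propose_timer : s.step = Phase.propose → sys.proposer s.height s.round ≠ p →
    ∃ d, (⟨Phase.propose, s.height, s.round, d⟩ : Timer) ∈ s.timers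
  prevote_timer : s.anyPrevotesDone = true → s.step ≠ Phase.propose ∧
    (s.step = Phase.precommit ∨ ∃ d, (⟨Phase.prevote, s.height, s.round, d⟩ : Timer) ∈ s.timers)
  precommit_timer : s.anyPrecommitsDone = true →
    ∃ d, (⟨Phase.precommit, s.height, s.round, d⟩ : Timer) ∈ s.timers
  polka_done : s.polkaDone = true → s.step = Phase.precommit ∧ s.validRound = s.round

structure Inv (sys : System par P V I) (p : P) (s : LState P V I) : Prop extends
    BaseInv sys p s where
  run : Active sys s → RunInv sys p s

lemma Inv.initial (sys : System par P V I) (p : P) : Inv sys p LState.initial where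
  decided := by simp [LState.initial]
  fresh := by simp [LState.initial]
  locked_ge := by simp [LState.initial]
  locked_le := by simp [LState.initial]
  valid_spec := Or.inl ⟨rfl, rfl⟩
  sent_src := by simp [LState.initial]
  sent_past := by simp [LState.initial]
  sent_log := by simp [LState.initial]
  prevote_unique := by simp [LState.initial]
  proposal_unique := by simp [LState.initial]
  timer_past := by simp [LState.initial]
  run := by simp [LState.initial, Active]

/-- All earlier messages and timers lie strictly before the new round, so the new proposal is the
only one of its round. `RunInv` need not hold beforehand: `StartRound` resets the flags and the
step, and supplies the proposal or the propose timer. -/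
lemma BaseInv.startRound {sys : System par P V I} {p : P} {s : LState P V I} {r : ℕ} (now : ℝ)
    (H : BaseInv sys p s) (hs : s.started = true)
    (hsent : ∀ m ∈ s.sent, m.height < s.height ∨ m.height = s.height ∧ m.round < r)
    (htm : ∀ tm ∈ s.timers, tm.height < s.height ∨ tm.height = s.height ∧ tm.round < r)
    (hvalid : ValidSpec sys s.log s.height r s.validRound s.validValue) :
    Inv sys p (startRound sys p now s r) := by
  obtain ⟨h1, h2, h3, h4, h5, h6, h7, h8, h9, h10, h11⟩ := H
  by_cases hp : sys.proposer s.height r = p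
  · have hv : sys.valid (s.validValue.getD (sys.getValue p s.height r)) := by
      rcases hvalid with ⟨-, h⟩ | ⟨n, v, -, -, h, hv, -⟩
      · rw [h]; exact sys.getValue_valid _ _ _
      · rw [h]; exact hv
    have hV := hvalid
    have hvv : s.validValue = none ∨
        s.validValue = some (s.validValue.getD (sys.getValue p s.height r)) := by
      cases s.validValue <;> simp
    simp only [Tendermint.startRound, hp, if_true, LState.broadcast]
    refine ⟨⟨h1, h2, h3, h4, ?_, ?_, ?_, ?_, ?_, ?_, ?_⟩, fun _ => ⟨?_, ?_, ?_, ?_, ?_, ?_, ?_⟩⟩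
    · exact hvalid.mono (fun m hm _ => Or.inr hm) (Nat.le_succ r)
    · rintro m (rfl | hm)
      · rfl
      · exact h6 m hm
    · rintro m (rfl | hm)
      · simp [LState.Past, hs, Msg.num, Msg.height, Msg.round]
      · have := hsent m hm
        simp only [LState.Past, hs]
        grind
    · rintro m (rfl | hm) hh
      · exact Or.inl rfl
      · exact Or.inr (h8 m hm hh)
    · simpa using h9
    · rintro h r' v vr v' vr' (h | h) (h' | h')
      · grind
      · have := hsent _ h'
        simp only [Msg.height, Msg.round] at this
        grind
      · have := hsent _ h
        simp only [Msg.height, Msg.round] at this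
        grind
      · exact h10 _ _ _ _ _ _ h h'
    · intro tm hm
      have := htm tm hm
      simp only [LState.Past, hs]
      grind
    · simp
    · simp
    · intro _
      exact ⟨_, _, s.validValue, Or.inl rfl, hv, hvv, hV.mono (fun m hm _ => Or.inr hm) le_rfl⟩
    · simp [hp]
    · simp
    · simp
    · simp
  · simp only [Tendermint.startRound, hp, if_false, LState.schedule]
    refine ⟨⟨h1, h2, h3, h4, ?_, h6, ?_, h8, h9, h10, ?_⟩, fun _ => ⟨?_, ?_, ?_, ?_, ?_, ?_, ?_⟩⟩
    · exact hvalid.mono (fun m hm _ => hm) (Nat.le_succ r)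
    · intro m hm
      have := hsent m hm
      simp only [LState.Past, hs]
      grind
    · rintro tm (rfl | hm)
      · simp [LState.Past, hs, Timer.num]
      · have := htm tm hm
        simp only [LState.Past, hs]
        grind
    · simp
    · simp
    · simp [hp]
    · intro _ _
      exact ⟨_, Or.inl rfl⟩
    · simp
    · simp
    · simp

lemma BaseInv.startHeight {sys : System par P V I} {p : P} {s : LState P V I} (now : ℝ)
    (H : BaseInv sys p s) (hs : s.started = true)
    (hsent : ∀ m ∈ s.sent, m.height < s.height)
    (htm : ∀ tm ∈ s.timers, tm.height < s.height)
    (hvalid : s.validRound = -1) (hvalue : s.validValue = none) :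
    Inv sys p (startHeight sys p now s) := by
  unfold Tendermint.startHeight
  split_ifs with hh
  · exact H.startRound now hs (fun m hm => Or.inl (hsent m hm)) (fun m hm => Or.inl (htm m hm))
      (Or.inl ⟨hvalid, hvalue⟩)
  · exact ⟨H, fun h => absurd h.2 hh⟩

/-- The set `tms` lets one proof serve both the rules and the timeout handler, which also deletes a
timer. At step `prevote` the propose timer is no longer needed. -/
lemma Inv.castPrevote {sys : System par P V I} {p : P} {s : LState P V I} (H : Inv sys p s)
    (hst : s.started = true) (hstep : s.step = Phase.propose) (i : Option I) (tms : Set Timer)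
    (hsub : tms ⊆ s.timers)
    (hkeep : ∀ tm ∈ s.timers, tm.kind ≠ Phase.propose → tm ∈ tms) :
    Inv sys p (castPrevote p { s with timers := tms } i) := by
  obtain ⟨⟨h1, h2, h3, h4, h5, h6, h7, h8, h9, h10, h11⟩, hrun⟩ := H
  simp only [Tendermint.castPrevote, LState.broadcast]
  refine ⟨⟨h1, h2, h3, h4, ?_, ?_, ?_, ?_, ?_, ?_, ?_⟩, fun ha => ?_⟩
  · exact h5.mono (fun m hm _ => Or.inr hm) le_rfl
  · rintro m (rfl | hm)
    · rfl
    · exact h6 m hm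
  · rintro m (rfl | hm)
    · simp [LState.Past, hst, Msg.num, Msg.height, Msg.round, Phase.num]
    · have := h7 m hm
      simp only [LState.Past, hst, hstep, Phase.num] at this ⊢
      grind
  · rintro m (rfl | hm) hh
    · exact Or.inl rfl
    · exact Or.inr (h8 m hm hh)
  -- An earlier prevote of this round would contradict `sent_past`, since the step is still
  -- `propose`.
  · have key : ∀ i', Msg.prevote p s.height s.round i' ∉ s.sent := by
      intro i' hi
      have := h7 _ hi
      simp [LState.Past, hst, hstep, Phase.num, Msg.num, Msg.height, Msg.round] at this
    rintro h r j j' (hj | hj) (hj' | hj') <;> grind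
  · simpa using h10
  · intro tm hm
    have := h11 tm (hsub hm)
    simp only [LState.Past, hst, hstep, Phase.num] at this ⊢
    grind
  obtain ⟨r1, r2, r3, r4, r5, r6, r7⟩ := hrun ha
  refine ⟨?_, ?_, ?_, ?_, ?_, ?_, ?_⟩
  · intro _
    exact ⟨i, Or.inl rfl⟩
  · simp
  · intro hp
    obtain ⟨v, vr, vv, hm, hv, hvv, hsp⟩ := r3 hp
    exact ⟨v, vr, vv, Or.inr hm, hv, hvv, hsp.mono (fun m hm _ => Or.inr hm) le_rfl⟩
  · simp
  · intro h
    exact absurd hstep (r5 h).1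
  · intro h
    obtain ⟨d, hd⟩ := r6 h
    exact ⟨d, hkeep _ hd (by simp)⟩
  · intro h
    have := r7 h
    simp [hstep] at this

lemma Inv.castPrecommit {sys : System par P V I} {p : P} {s : LState P V I} (H : Inv sys p s)
    (hst : s.started = true) (hstep : s.step = Phase.prevote) (i : Option I) (tms : Set Timer)
    (hsub : tms ⊆ s.timers)
    (hkeep : ∀ tm ∈ s.timers, tm.kind ≠ Phase.prevote → tm ∈ tms) :
    Inv sys p (castPrecommit p { s with timers := tms } i) := by
  obtain ⟨⟨h1, h2, h3, h4, h5, h6, h7, h8, h9, h10, h11⟩, hrun⟩ := H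
  simp only [Tendermint.castPrecommit, LState.broadcast]
  refine ⟨⟨h1, h2, h3, h4, ?_, ?_, ?_, ?_, ?_, ?_, ?_⟩, fun ha => ?_⟩
  · exact h5.mono (fun m hm _ => Or.inr hm) le_rfl
  · rintro m (rfl | hm)
    · rfl
    · exact h6 m hm
  · rintro m (rfl | hm)
    · simp [LState.Past, hst, Msg.num, Msg.height, Msg.round, Phase.num]
    · have := h7 m hm
      simp only [LState.Past, hst, hstep, Phase.num] at this ⊢
      grind
  · rintro m (rfl | hm) hh
    · exact Or.inl rfl
    · exact Or.inr (h8 m hm hh)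
  · simpa using h9
  · simpa using h10
  · intro tm hm
    have := h11 tm (hsub hm)
    simp only [LState.Past, hst, hstep, Phase.num] at this ⊢
    grind
  obtain ⟨r1, r2, r3, r4, r5, r6, r7⟩ := hrun ha
  refine ⟨?_, ?_, ?_, ?_, ?_, ?_, ?_⟩
  · intro _
    obtain ⟨j, hj⟩ := r1 (by simp [hstep])
    exact ⟨j, Or.inr hj⟩
  · intro _
    exact ⟨i, Or.inl rfl⟩
  · intro hp
    obtain ⟨v, vr, vv, hm, hv, hvv, hsp⟩ := r3 hp
    exact ⟨v, vr, vv, Or.inr hm, hv, hvv, hsp.mono (fun m hm _ => Or.inr hm) le_rfl⟩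
  · simp
  · simp
  · intro h
    obtain ⟨d, hd⟩ := r6 h
    exact ⟨d, hkeep _ hd (by simp)⟩
  · intro h
    have := r7 h
    simp [hstep] at this

lemma Inv.schedule {sys : System par P V I} {p : P} {s : LState P V I} (H : Inv sys p s)
    (hs : s.started = true) (tm : Timer) (hh : tm.height = s.height) (hr : tm.round = s.round)
    (hnum : tm.num ≤ s.step.num) : Inv sys p (s.schedule tm) := by
  obtain ⟨⟨h1, h2, h3, h4, h5, h6, h7, h8, h9, h10, h11⟩, hrun⟩ := H
  refine ⟨⟨h1, h2, h3, h4, h5, h6, h7, h8, h9, h10, ?_⟩, fun ha => ?_⟩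
  · rintro tm' (rfl | hm)
    · simp [LState.Past, LState.schedule, *]
    · exact h11 tm' hm
  · obtain ⟨r1, r2, r3, r4, r5, r6, r7⟩ := hrun ha
    refine ⟨r1, r2, r3, ?_, ?_, ?_, r7⟩
    · intro h h'
      obtain ⟨d, hd⟩ := r4 h h'
      exact ⟨d, Or.inr hd⟩
    · intro h
      obtain ⟨h, h'⟩ := r5 h
      exact ⟨h, h'.imp id fun ⟨d, hd⟩ => ⟨d, Or.inr hd⟩⟩
    · intro h
      obtain ⟨d, hd⟩ := r6 h
      exact ⟨d, Or.inr hd⟩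

lemma Inv.onPolka {sys : System par P V I} {p : P} {s : LState P V I} (H : Inv sys p s)
    (hs : Active sys s) (v : V)
    (hquorum : 2 * par.f + 1 ≤
        sys.weight (prevotersFor s.log s.height s.round (some (sys.idOf v))))
    (hvalid : sys.valid v) (hstep : s.step = Phase.prevote ∨ s.step = Phase.precommit) :
    Inv sys p (onPolka sys p s v) := by
  -- Both branches of the rule end at step `precommit` and differ only in the lock, which is left
  -- arbitrary here.
  have key : ∀ (s : LState P V I), Inv sys p s → Active sys s → s.step = Phase.precommit →
      2 * par.f + 1 ≤ sys.weight (prevotersFor s.log s.height s.round (some (sys.idOf v))) →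
      ∀ lv lr, -1 ≤ lr → lr ≤ (s.round : ℤ) → Inv sys p { s with
        lockedValue := lv, lockedRound := lr, validValue := some v, validRound := s.round,
        polkaDone := true } := by
    rintro s ⟨⟨h1, h2, h3, h4, h5, h6, h7, h8, h9, h10, h11⟩, hrun⟩ ha hst hq lv lr hlr hlr'
    obtain ⟨r1, r2, r3, r4, r5, r6, r7⟩ := hrun ha
    refine ⟨⟨h1, ?_, hlr, hlr', ?_, h6, h7, h8, h9, h10, h11⟩,
      fun _ => ⟨r1, r2, r3, r4, r5, r6, fun _ => ⟨hst, rfl⟩⟩⟩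
    · simp [ha.1]
    · exact Or.inr ⟨s.round, v, rfl, Nat.lt_succ_self _, rfl, hvalid, hq⟩
  have hle : s.lockedRound ≤ s.round := by
    refine H.locked_le.trans ?_
    rcases H.valid_spec with ⟨h, -⟩ | ⟨n, v, h, hn, -⟩ <;> omega
  unfold Tendermint.onPolka
  split_ifs with h
  · exact key _ (H.castPrecommit hs.1 h (some (sys.idOf v)) s.timers subset_rfl fun _ h _ => h)
      hs rfl (hquorum.trans (sys.weight_mono (prevotersFor_mono fun m hm _ => Or.inr hm)))
      (some v) s.round (by simp) le_rfl
  · exact key s H hs (hstep.resolve_left h) hquorum s.lockedValue s.lockedRound H.locked_ge hle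

lemma Inv.lt_of_sent {sys : System par P V I} {p : P} {s : LState P V I} (H : Inv sys p s)
    {m : Msg P V I} (hm : m ∈ s.sent) :
    m.height < s.height ∨ m.height = s.height ∧ m.round ≤ s.round := by
  have := (H.sent_past m hm).2
  grind

lemma Inv.lt_of_timer {sys : System par P V I} {p : P} {s : LState P V I} (H : Inv sys p s)
    {tm : Timer} (hm : tm ∈ s.timers) :
    tm.height < s.height ∨ tm.height = s.height ∧ tm.round ≤ s.round := by
  have := (H.timer_past tm hm).2
  grind

/-- Everything sent or scheduled belongs to heights up to the finished one, so it precedes the new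
instance. Pruning the log is harmless because `sent_log` concerns open heights only. -/
lemma Inv.decide {sys : System par P V I} {p : P} {s : LState P V I} (H : Inv sys p s)
    (hs : Active sys s) (now : ℝ) (v : V) : Inv sys p (decide sys p now s v) := by
  have h6 := fun m hm => H.lt_of_sent (m := m) hm
  have h7 := fun m hm => H.lt_of_timer (tm := m) hm
  obtain ⟨⟨h1, h2, h3, h4, h5, hsrc, h7', h8, h9, h10, h11⟩, hrun⟩ := H
  unfold Tendermint.decide
  refine BaseInv.startHeight now ⟨?_, ?_, le_rfl, le_rfl, Or.inl ⟨rfl, rfl⟩, hsrc, ?_, ?_, h9, h10,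
    ?_⟩ hs.1 ?_ ?_ rfl rfl
  · intro h
    by_cases hh : h = s.height
    · subst hh; simp
    · simp only [Function.update_of_ne hh, h1]; omega
  · simp
  · intro m hm
    refine ⟨hs.1, Or.inl ?_⟩
    have := h6 m hm
    simp only
    omega
  · intro m hm hh
    simp only at hh
    exact ⟨h8 m hm (by omega), hh⟩
  · intro m hm
    refine ⟨hs.1, Or.inl ?_⟩
    have := h7 m hm
    simp only
    omega
  · intro m hm
    have := h6 m hm
    simp only
    omega
  · intro m hm
    have := h7 m hm
    simp only
    omega

lemma Inv.startRound {sys : System par P V I} {p : P} {s : LState P V I} (H : Inv sys p s)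
    (hs : s.started = true) (now : ℝ) {r : ℕ} (hr : s.round < r) (tms : Set Timer)
    (hsub : tms ⊆ s.timers) :
    Inv sys p (startRound sys p now { s with timers := tms } r) := by
  have h6 := fun m hm => H.lt_of_sent (m := m) hm
  have h7 := fun m hm => H.lt_of_timer (tm := m) hm
  obtain ⟨⟨h1, h2, h3, h4, h5, hsrc, h7', h8, h9, h10, h11⟩, hrun⟩ := H
  refine BaseInv.startRound now ⟨h1, h2, h3, h4, h5, hsrc, h7', h8, h9, h10, ?_⟩ hs ?_ ?_ ?_
  · exact fun tm htm => h11 tm (hsub htm)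
  · intro m hm
    have := h6 m hm
    simp only
    omega
  · intro m hm
    have := h7 m (hsub hm)
    simp only
    omega
  · exact h5.mono (fun m hm _ => hm) hr

lemma Inv.rule {sys : System par P V I} {p : P} {s s' : LState P V I} {now : ℝ}
    (H : Inv sys p s) (hs : Active sys s) (hrule : Rule sys p now s s') : Inv sys p s' := by
  cases hrule with
  | newProposal v hmsg hstep =>
    exact H.castPrevote hs.1 hstep _ s.timers subset_rfl fun _ h _ => h
  | oldProposal v vr hmsg hquorum hstep hvr =>
    exact H.castPrevote hs.1 hstep _ s.timers subset_rfl fun _ h _ => h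
  | anyPrevotes hquorum hstep hfirst =>
    have H' := H.schedule hs.1 ⟨Phase.prevote, s.height, s.round,
      now + par.timeoutPrevote s.round⟩ rfl rfl (by simp [hstep, Timer.num, Phase.num])
    refine ⟨⟨H'.1.1, H'.1.2, H'.1.3, H'.1.4, H'.1.5, H'.1.6, H'.1.7, H'.1.8, H'.1.9, H'.1.10,
      H'.1.11⟩, fun ha => ?_⟩
    obtain ⟨r1, r2, r3, r4, r5, r6, r7⟩ := H'.run ha
    exact ⟨r1, r2, r3, r4, fun _ => ⟨by simp [LState.schedule, hstep],
      Or.inr ⟨_, Or.inl rfl⟩⟩, r6, r7⟩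
  | polka v vr hmsg hquorum hvalid hstep hfirst => exact H.onPolka hs v hquorum hvalid hstep
  | nilPrevotes hquorum hstep =>
    exact H.castPrecommit hs.1 hstep _ s.timers subset_rfl fun _ h _ => h
  | anyPrecommits hquorum hfirst =>
    have H' := H.schedule hs.1 ⟨Phase.precommit, s.height, s.round,
      now + par.timeoutPrecommit s.round⟩ rfl rfl (by simp [Timer.num])
    refine ⟨⟨H'.1.1, H'.1.2, H'.1.3, H'.1.4, H'.1.5, H'.1.6, H'.1.7, H'.1.8, H'.1.9, H'.1.10,
      H'.1.11⟩, fun ha => ?_⟩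
    obtain ⟨r1, r2, r3, r4, r5, r6, r7⟩ := H'.run ha
    exact ⟨r1, r2, r3, r4, r5, fun _ => ⟨_, Or.inl rfl⟩, r7⟩
  | decision r v vr hmsg hquorum hundecided hvalid => exact H.decide hs now v
  | skipRound r hquorum hr => exact H.startRound hs.1 now hr s.timers subset_rfl

lemma Inv.onTimeout {sys : System par P V I} {p : P} {s : LState P V I} {tm : Timer}
    (H : Inv sys p s) (htm : tm ∈ s.timers) (now : ℝ) :
    Inv sys p (onTimeout sys p now s tm) := by
  have hst := (H.timer_past tm htm).1
  have hsub : s.timers \ {tm} ⊆ s.timers := Set.sdiff_subset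
  -- Deleting a timer without other effect is harmless when no clause of `RunInv` still relies on
  -- it: the timer is stale or the step it serves has been left.
  have hrm : (Active sys s → tm.height = s.height ∧ tm.round = s.round →
      ¬(tm.kind = Phase.propose ∧ s.step = Phase.propose) ∧
      ¬(tm.kind = Phase.prevote ∧ s.step = Phase.prevote) ∧ tm.kind ≠ Phase.precommit) →
      Inv sys p { s with timers := s.timers \ {tm} } := by
    intro hne
    obtain ⟨⟨h1, h2, h3, h4, h5, h6, h7, h8, h9, h10, h11⟩, hrun⟩ := H
    refine ⟨⟨h1, h2, h3, h4, h5, h6, h7, h8, h9, h10, fun t ht => h11 t ht.1⟩, fun ha => ?_⟩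
    obtain ⟨r1, r2, r3, r4, r5, r6, r7⟩ := hrun ha
    have hne' := hne ha
    refine ⟨r1, r2, r3, ?_, ?_, ?_, r7⟩
    · intro h h'
      obtain ⟨d, hd⟩ := r4 h h'
      refine ⟨d, hd, fun heq => ?_⟩
      have heq : (⟨Phase.propose, s.height, s.round, d⟩ : Timer) = tm := heq
      exact (hne' ⟨by rw [← heq], by rw [← heq]⟩).1 ⟨by rw [← heq], h⟩
    · intro h
      obtain ⟨hp, h⟩ := r5 h
      refine ⟨hp, ?_⟩
      by_cases hc : s.step = Phase.precommit
      · exact Or.inl hc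
      obtain ⟨d, hd⟩ := h.resolve_left hc
      refine Or.inr ⟨d, hd, fun heq => ?_⟩
      have heq : (⟨Phase.prevote, s.height, s.round, d⟩ : Timer) = tm := heq
      refine (hne' ⟨by rw [← heq], by rw [← heq]⟩).2.1 ⟨by rw [← heq], ?_⟩
      cases hstep : s.step <;> simp_all
    · intro h
      obtain ⟨d, hd⟩ := r6 h
      refine ⟨d, hd, fun heq => ?_⟩
      have heq : (⟨Phase.precommit, s.height, s.round, d⟩ : Timer) = tm := heq
      exact (hne' ⟨by rw [← heq], by rw [← heq]⟩).2.2 (by rw [← heq])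
  unfold Tendermint.onTimeout
  by_cases hcur : tm.height = s.height ∧ tm.round = s.round
  · simp only [hcur, and_self, if_true]
    cases hk : tm.kind with
    | propose =>
      by_cases hstep : s.step = Phase.propose
      · simp only [hstep, if_true]
        refine H.castPrevote hst hstep _ _ hsub fun t ht hne => ⟨ht, ?_⟩
        rintro rfl
        exact hne hk
      · simp only [hstep, if_false]
        exact hrm fun _ _ => by simp [hk, hstep]
    | prevote =>
      by_cases hstep : s.step = Phase.prevote
      · simp only [hstep, if_true]
        refine H.castPrecommit hst hstep _ _ hsub fun t ht hne => ⟨ht, ?_⟩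
        rintro rfl
        exact hne hk
      · simp only [hstep, if_false]
        exact hrm fun _ _ => by simp [hk, hstep]
    | precommit => exact H.startRound hst now (Nat.lt_succ_self _) _ hsub
  · simp only [hcur, if_false]
    exact hrm fun _ h => absurd h hcur

lemma Inv.localStep {sys : System par P V I} {p : P} {s s' : LState P V I} {now : ℝ}
    {rcv : Msg P V I → Prop} (H : Inv sys p s) (hstep : LocalStep sys p now rcv s s') :
    Inv sys p s' := by
  cases hstep with
  | idle => exact H
  | start hs =>
    -- Since `Past` includes having started, nothing has been sent or scheduled before the start.
    have hno : ∀ {h r x}, ¬ s.Past h r x := fun h => by simp [h.1] at hs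
    obtain ⟨⟨h1, h2, h3, h4, h5, h6, h7, h8, h9, h10, h11⟩, hrun⟩ := H
    have hvr := h2 hs
    refine BaseInv.startHeight now ⟨h1, by simp, h3, h4, h5, h6, ?_, h8, h9, h10, ?_⟩ rfl
      (fun m hm => (hno (h7 m hm)).elim) (fun m hm => (hno (h11 m hm)).elim) hvr ?_
    · exact fun m hm => (hno (h7 m hm)).elim
    · exact fun m hm => (hno (h11 m hm)).elim
    · rcases h5 with h | ⟨n, v, h, -⟩
      · exact h.2
      · omega
  | receive m hm =>
    obtain ⟨⟨h1, h2, h3, h4, h5, h6, h7, h8, h9, h10, h11⟩, hrun⟩ := H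
    refine ⟨⟨h1, h2, h3, h4, h5.mono (fun m hm _ => Or.inr hm) le_rfl, h6, h7,
      fun m hm h => Or.inr (h8 m hm h), h9, h10, h11⟩, fun ha => ?_⟩
    obtain ⟨r1, r2, r3, r4, r5, r6, r7⟩ := hrun ha
    refine ⟨r1, r2, fun hp => ?_, r4, r5, r6, r7⟩
    obtain ⟨v, vr, vv, hm, hv, hvv, hsp⟩ := r3 hp
    exact ⟨v, vr, vv, hm, hv, hvv, hsp.mono (fun m hm _ => Or.inr hm) le_rfl⟩
  | rule _ ha hr => exact H.rule ha hr
  | timeout tm htm hdue => exact H.onTimeout htm now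

/-! ### Effects of local steps and the reasons behind them. -/

/-- A common form for proposers and non-proposers, so that later case distinctions need not ask who
proposes. -/
lemma startRound_eq (sys : System par P V I) (p : P) (now : ℝ) (s : LState P V I) (r : ℕ) :
    ∃ (log sent : Set (Msg P V I)) (tms : Set Timer),
    startRound sys p now s r = { s with
      round := r, step := Phase.propose, anyPrevotesDone := false, polkaDone := false,
      anyPrecommitsDone := false, log := log, sent := sent, timers := tms } ∧
    s.log ⊆ log ∧ s.sent ⊆ sent ∧ s.timers ⊆ tms ∧
    (∀ m ∈ log, m ∈ s.log ∨ m ∈ sent) ∧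
    (∀ m ∈ sent, m ∈ s.sent ∨ ∃ v, m = Msg.proposal p s.height r v s.validRound) ∧
    (∀ tm ∈ tms, tm ∈ s.timers ∨
      tm = ⟨Phase.propose, s.height, r, now + par.timeoutPropose r⟩) := by
  unfold startRound
  split_ifs with h
  · refine ⟨_, _, _, rfl, Set.subset_insert _ _, Set.subset_insert _ _, subset_rfl, ?_, ?_, ?_⟩
    · rintro m (rfl | hm)
      · exact Or.inr (Or.inl rfl)
      · exact Or.inl hm
    · rintro m (rfl | hm)
      · exact Or.inr ⟨_, rfl⟩
      · exact Or.inl hm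
    · exact fun tm h => Or.inl h
  · refine ⟨_, _, _, rfl, subset_rfl, subset_rfl, Set.subset_insert _ _, ?_, ?_, ?_⟩
    · exact fun m h => Or.inl h
    · exact fun m h => Or.inl h
    · rintro m (rfl | hm)
      · exact Or.inr rfl
      · exact Or.inl hm

/-- The reason for which a process in state `s` broadcasts a prevote for `i`. -/
def PrevoteReason (sys : System par P V I) (now : ℝ) (s : LState P V I) (i : Option I) : Prop :=
  (∃ v, Msg.proposal (sys.proposer s.height s.round) s.height s.round v (-1) ∈ s.log ∧
    (sys.valid v ∧ (s.lockedRound = -1 ∨ s.lockedValue = some v) → i = some (sys.idOf v))) ∨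
  (∃ v, ∃ vr : ℕ,
    Msg.proposal (sys.proposer s.height s.round) s.height s.round v (vr : ℤ) ∈ s.log ∧
    vr < s.round ∧
    2 * par.f + 1 ≤ sys.weight (prevotersFor s.log s.height vr (some (sys.idOf v))) ∧
    (sys.valid v ∧ (s.lockedRound ≤ vr ∨ s.lockedValue = some v) → i = some (sys.idOf v))) ∨
  (∃ d ≤ now, (⟨Phase.propose, s.height, s.round, d⟩ : Timer) ∈ s.timers)

/-- The reason for which a process in state `s` broadcasts a precommit for `i`. -/
def PrecommitReason (sys : System par P V I) (now : ℝ) (s : LState P V I) (i : Option I) : Prop :=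
  (∃ v vr, Msg.proposal (sys.proposer s.height s.round) s.height s.round v vr ∈ s.log ∧
    2 * par.f + 1 ≤ sys.weight (prevotersFor s.log s.height s.round (some (sys.idOf v))) ∧
    sys.valid v ∧ i = some (sys.idOf v)) ∨
  (2 * par.f + 1 ≤ sys.weight (prevotersFor s.log s.height s.round none)) ∨
  (∃ d ≤ now, (⟨Phase.prevote, s.height, s.round, d⟩ : Timer) ∈ s.timers)

/-- The reason for which a process in state `s` decides. -/
def DecisionReason (sys : System par P V I) (s : LState P V I) : Prop :=
  ∃ r v vr, Msg.proposal (sys.proposer s.height r) s.height r v vr ∈ s.log ∧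
    2 * par.f + 1 ≤ sys.weight (precommittersFor s.log s.height r (some (sys.idOf v))) ∧
    sys.valid v

/-- The effect of a step of a single process in an arbitrary state. -/
inductive Effect (sys : System par P V I) (p : P) (now : ℝ) (rcv : Msg P V I → Prop)
    (s : LState P V I) : LState P V I → Prop
  | receive (log : Set (Msg P V I)) (hsub : s.log ⊆ log) (hrcv : ∀ m ∈ log, m ∈ s.log ∨ rcv m) :
      Effect sys p now rcv s { s with log := log }
  | expire (tm : Timer) (htm : tm ∈ s.timers) (hpast : s.Past tm.height tm.round (tm.kind.num + 1)) :
      Effect sys p now rcv s { s with timers := s.timers \ {tm} }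
  | begin (log sent : Set (Msg P V I)) (tms : Set Timer) (step : Phase) (r : ℕ) (b₁ b₂ b₃ : Bool)
      (hs : s.started = false) (hr : r = 0 ∨ ¬ (s.height : ℕ∞) < sys.heights) (hsub : s.log ⊆ log)
      (hsent : s.sent ⊆ sent) (htm : s.timers ⊆ tms)
      (hlog : ∀ m ∈ log, m ∈ s.log ∨ m ∈ sent)
      (hnew : ∀ m ∈ sent, m ∈ s.sent ∨ ∃ v, m = Msg.proposal p s.height r v s.validRound)
      (hnewtm : ∀ tm ∈ tms, tm ∈ s.timers ∨
        tm = ⟨Phase.propose, s.height, r, now + par.timeoutPropose r⟩) :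
      Effect sys p now rcv s { s with
        started := true, round := r, step := step, anyPrevotesDone := b₁, polkaDone := b₂,
        anyPrecommitsDone := b₃, log := log, sent := sent, timers := tms }
  | advance (log sent : Set (Msg P V I)) (tms : Set Timer) (r : ℕ)
      (hs : s.started = true) (hr : s.round < r) (hsub : s.log ⊆ log)
      (hsent : s.sent ⊆ sent)
      (htm : ∀ tm ∈ s.timers, tm ∈ tms ∨
        (tm.height = s.height ∧ tm.round < r))
      (hlog : ∀ m ∈ log, m ∈ s.log ∨ m ∈ sent)
      (hnew : ∀ m ∈ sent, m ∈ s.sent ∨ ∃ v, m = Msg.proposal p s.height r v s.validRound)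
      (hnewtm : ∀ tm ∈ tms, tm ∈ s.timers ∨
        tm = ⟨Phase.propose, s.height, r, now + par.timeoutPropose r⟩)
      (hreason : par.f + 1 ≤ sys.weight (senders s.log s.height r) ∨
        r = s.round + 1 ∧ ∃ d ≤ now, (⟨Phase.precommit, s.height, s.round, d⟩ : Timer) ∈ s.timers) :
      Effect sys p now rcv s { s with
        round := r, step := Phase.propose, anyPrevotesDone := false, polkaDone := false,
        anyPrecommitsDone := false, log := log, sent := sent, timers := tms }
  | prevote (i : Option I) (tms : Set Timer) (hs : s.started = true)
      (hstep : s.step = Phase.propose)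
      (hsub : tms ⊆ s.timers)
      (htm : ∀ tm ∈ s.timers, tm ∈ tms ∨
        (tm.kind = Phase.propose ∧ tm.height = s.height ∧ tm.round = s.round))
      (hreason : PrevoteReason sys now s i) :
      Effect sys p now rcv s (castPrevote p { s with timers := tms } i)
  | precommit (i : Option I) (tms : Set Timer) (vv lv : Option V) (vr lr : ℤ) (b : Bool)
      (hs : s.started = true) (hstep : s.step = Phase.prevote)
      (hsub : tms ⊆ s.timers)
      (htm : ∀ tm ∈ s.timers, tm ∈ tms ∨
        (tm.kind = Phase.prevote ∧ tm.height = s.height ∧ tm.round = s.round))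
      (hreason : PrecommitReason sys now s i)
      (hlock : (vr = s.validRound ∧ lr = s.lockedRound) ∨ (vr = s.round ∧ lr = s.round ∧
        ∃ v vr, Msg.proposal (sys.proposer s.height s.round) s.height s.round v vr ∈ s.log ∧
    2 * par.f + 1 ≤ sys.weight (prevotersFor s.log s.height s.round (some (sys.idOf v))) ∧
    sys.valid v)) :
      Effect sys p now rcv s (castPrecommit p { s with
        timers := tms, lockedValue := lv, lockedRound := lr, validValue := vv, validRound := vr,
        polkaDone := b } i)
  | valid (vv : Option V) (hs : s.started = true) (hstep : s.step = Phase.precommit) :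
      Effect sys p now rcv s
        { s with validValue := vv, validRound := s.round, polkaDone := true }
  | timer (tm : Timer) (b₁ b₂ : Bool) (hs : s.started = true) (hh : tm.height = s.height)
      (hr : tm.round = s.round) (hd : tm.deadline = now + par.timeout tm.kind tm.round)
      (hreason : tm.kind = Phase.prevote ∧
          2 * par.f + 1 ≤ sys.weight (prevoters s.log s.height s.round) ∨
        tm.kind = Phase.precommit ∧
          2 * par.f + 1 ≤ sys.weight (precommitters s.log s.height s.round)) :
      Effect sys p now rcv s { s with
        timers := insert tm s.timers, anyPrevotesDone := b₁, anyPrecommitsDone := b₂ }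
  | decide (s' : LState P V I) (hs : s.started = true) (hreason : DecisionReason sys s)
      (hs' : s'.started = true) (hh : s'.height = s.height + 1)
      (hlog : ∀ m ∈ s.log, s'.height ≤ m.height → m ∈ s'.log)
      (hlog' : ∀ m ∈ s'.log, m ∈ s.log ∨ m ∈ s'.sent)
      (hsent : s.sent ⊆ s'.sent)
      (hnew : ∀ m ∈ s'.sent, m ∈ s.sent ∨ ∃ v,
        m = Msg.proposal p s'.height s'.round v s'.validRound)
      (htm : s.timers ⊆ s'.timers)
      (hnewtm : ∀ tm ∈ s'.timers, tm ∈ s.timers ∨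
        tm = ⟨Phase.propose, s'.height, s'.round, now + par.timeoutPropose s'.round⟩)
      (hdec : s'.decision s.height ≠ none)
      (hround : s'.round = 0 ∨ ¬ (s'.height : ℕ∞) < sys.heights) (hvr : s'.validRound = -1) :
      Effect sys p now rcv s s'

/-- The invariant is needed for timeouts only: a timer is never ahead of its process, so one that
triggers nothing belongs to a phase already passed. -/
lemma LocalStep.effect {sys : System par P V I} {p : P} {s s' : LState P V I} {now : ℝ}
    {rcv : Msg P V I → Prop} (H : Inv sys p s) (hstep : LocalStep sys p now rcv s s') :
    Effect sys p now rcv s s' := by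
  cases hstep with
  | idle => exact Effect.receive s.log subset_rfl fun _ h => Or.inl h
  | start hs =>
    unfold startHeight
    split_ifs with hh
    · obtain ⟨log, sent, tms, heq, h1, h2, h3, h4, h5, h6⟩ :=
        startRound_eq sys p now { s with started := true } 0
      rw [heq]
      exact Effect.begin log sent tms _ 0 _ _ _ hs (Or.inl rfl) h1 h2 h3 h4 h5 h6
    · exact Effect.begin s.log s.sent s.timers _ s.round _ _ _ hs (Or.inr hh) subset_rfl
        subset_rfl subset_rfl (fun _ h => Or.inl h) (fun _ h => Or.inl h) (fun _ h => Or.inl h)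
  | receive m hm =>
    exact Effect.receive _ (Set.subset_insert _ _) fun m' h =>
      h.elim (fun h => Or.inr (h ▸ hm)) Or.inl
  | rule _ ha hr =>
    cases hr with
    | newProposal v hmsg hstep =>
      refine Effect.prevote _ s.timers ha.1 hstep subset_rfl (fun _ h => Or.inl h)
        (Or.inl ⟨v, hmsg, fun h => if_pos h⟩)
    | oldProposal v vr hmsg hquorum hstep hvr =>
      refine Effect.prevote _ s.timers ha.1 hstep subset_rfl (fun _ h => Or.inl h)
        (Or.inr (Or.inl ⟨v, vr, hmsg, hvr, hquorum, fun h => if_pos h⟩))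
    | anyPrevotes hquorum hstep hfirst =>
      exact Effect.timer _ _ _ ha.1 rfl rfl rfl (Or.inl ⟨rfl, hquorum⟩)
    | polka v vr hmsg hquorum hvalid hstep hfirst =>
      unfold onPolka
      by_cases h : s.step = Phase.prevote
      · simp only [h, if_true]
        exact Effect.precommit _ s.timers (some v) (some v) s.round s.round true ha.1 h subset_rfl
          (fun _ h => Or.inl h) (Or.inl ⟨v, vr, hmsg, hquorum, hvalid, rfl⟩)
          (Or.inr ⟨rfl, rfl, v, vr, hmsg, hquorum, hvalid⟩)
      · simp only [h, if_false]
        exact Effect.valid _ ha.1 (hstep.resolve_left h)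
    | nilPrevotes hquorum hstep =>
      exact Effect.precommit _ s.timers _ _ s.validRound s.lockedRound _ ha.1 hstep subset_rfl
        (fun _ h => Or.inl h) (Or.inr (Or.inl hquorum)) (Or.inl ⟨rfl, rfl⟩)
    | anyPrecommits hquorum hfirst =>
      exact Effect.timer _ _ _ ha.1 rfl rfl rfl (Or.inr ⟨rfl, hquorum⟩)
    | decision r v vr hmsg hquorum hundecided hvalid =>
      have hR : DecisionReason sys s := ⟨r, v, vr, hmsg, hquorum, hvalid⟩
      unfold Tendermint.decide startHeight
      split_ifs with hh
      · obtain ⟨log, sent, tms, heq, h1, h2, h3, h4, h5, h6⟩ := startRound_eq sys p now { s with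
          decision := Function.update s.decision s.height (some v)
          height := s.height + 1
          lockedValue := none
          lockedRound := -1
          validValue := none
          validRound := -1
          log := {m ∈ s.log | s.height + 1 ≤ m.height} } 0
        rw [heq]
        exact Effect.decide _ ha.1 hR ha.1 rfl (fun m hm h => h1 ⟨hm, h⟩)
          (fun m hm => (h4 m hm).imp And.left id) h2 h5 h3 h6 (by simp) (Or.inl rfl) rfl
      · exact Effect.decide _ ha.1 hR ha.1 rfl (fun m hm h => ⟨hm, h⟩)
          (fun m hm => Or.inl hm.1) subset_rfl (fun _ h => Or.inl h) subset_rfl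
          (fun _ h => Or.inl h) (by simp) (Or.inr hh) rfl
    | skipRound r hquorum hr =>
      obtain ⟨log, sent, tms, heq, h1, h2, h3, h4, h5, h6⟩ := startRound_eq sys p now s r
      rw [heq]
      exact Effect.advance log sent tms r ha.1 hr h1 h2 (fun _ h => Or.inl (h3 h)) h4 h5 h6
        (Or.inl hquorum)
  | timeout tm htm hdue =>
    have hP := H.timer_past tm htm
    have hst := hP.1
    have hmem : ∀ t ∈ s.timers, t ∈ s.timers \ {tm} ∨ t = tm := by
      intro t ht
      by_cases h : t = tm
      · exact Or.inr h
      · exact Or.inl ⟨ht, h⟩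
    have hsub : s.timers \ {tm} ⊆ s.timers := Set.sdiff_subset
    unfold onTimeout
    by_cases hcur : tm.height = s.height ∧ tm.round = s.round
    · simp only [hcur, and_self, if_true]
      cases hk : tm.kind with
      | propose =>
        by_cases hstep : s.step = Phase.propose
        · simp only [hstep, if_true]
          refine Effect.prevote _ _ hst hstep hsub
            (fun t ht => (hmem t ht).imp id (by rintro rfl; exact ⟨hk, hcur.1, hcur.2⟩))
            (Or.inr (Or.inr ⟨tm.deadline, hdue, ?_⟩))
          rw [← hcur.1, ← hcur.2, ← hk]
          exact htm
        · simp only [hstep, if_false]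
          refine Effect.expire tm htm ⟨hst, Or.inr ⟨hcur.1.symm, Or.inr ⟨hcur.2.symm, ?_⟩⟩⟩
          cases h : s.step <;> simp_all [Phase.num]
      | prevote =>
        by_cases hstep : s.step = Phase.prevote
        · simp only [hstep, if_true]
          refine Effect.precommit _ _ _ _ s.validRound s.lockedRound _ hst hstep hsub
            (fun t ht => (hmem t ht).imp id (by rintro rfl; exact ⟨hk, hcur.1, hcur.2⟩))
            (Or.inr (Or.inr ⟨tm.deadline, hdue, ?_⟩)) (Or.inl ⟨rfl, rfl⟩)
          rw [← hcur.1, ← hcur.2, ← hk]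
          exact htm
        · simp only [hstep, if_false]
          refine Effect.expire tm htm ⟨hst, Or.inr ⟨hcur.1.symm, Or.inr ⟨hcur.2.symm, ?_⟩⟩⟩
          have := hP.2
          simp only [hcur, Timer.num, hk, Phase.num] at this ⊢
          cases h : s.step <;> simp_all
      | precommit =>
        obtain ⟨log, sent, tms, heq, h1, h2, h3, h4, h5, h6⟩ :=
          startRound_eq sys p now { s with timers := s.timers \ {tm} } (s.round + 1)
        simp only
        rw [heq]
        refine Effect.advance log sent tms _ hst (Nat.lt_succ_self _) h1 h2 ?_ h4 h5 ?_
          (Or.inr ⟨rfl, tm.deadline, hdue, ?_⟩)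
        · refine fun t ht => (hmem t ht).imp (fun h => h3 h) ?_
          rintro rfl
          exact ⟨hcur.1, by omega⟩
        · exact fun t ht => (h6 t ht).imp (fun h => h.1) id
        · rw [← hcur.1, ← hcur.2, ← hk]
          exact htm
    · simp only [hcur, if_false]
      refine Effect.expire tm htm ⟨hst, ?_⟩
      have := hP.2
      omega

namespace Effect

variable {sys : System par P V I} {p : P} {now : ℝ} {rcv : Msg P V I → Prop}
  {s s' : LState P V I}

lemma past_mono (he : Effect sys p now rcv s s') {h r x : ℕ} (hs : s.Past h r x) :
    s'.Past h r x := by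
  have h1 := hs.1
  cases he <;> simp_all only [LState.Past, castPrevote, castPrecommit, LState.broadcast, Phase.num,
    true_and] <;> grind

lemma height_mono (he : Effect sys p now rcv s s') : s.height ≤ s'.height := by
  cases he <;> simp_all [castPrevote, castPrecommit, LState.broadcast]

lemma sent_mono (he : Effect sys p now rcv s s') : s.sent ⊆ s'.sent := by
  cases he <;> simp_all [castPrevote, castPrecommit, LState.broadcast]

lemma log_mono (he : Effect sys p now rcv s s') {m : Msg P V I} (hm : m ∈ s.log)
    (hh : s'.height ≤ m.height) : m ∈ s'.log := by
  cases he <;> simp_all [castPrevote, castPrecommit, LState.broadcast] <;> grind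

lemma log_source (he : Effect sys p now rcv s s') {m : Msg P V I} (hm : m ∈ s'.log) :
    m ∈ s.log ∨ m ∈ s'.sent ∨ rcv m := by
  cases he <;> simp_all [castPrevote, castPrecommit, LState.broadcast] <;> grind

/-- A timer disappears only on expiry or when its phase is left. For a precommit timer the position
`kind.num + 1 = 3` is beyond every step, so it stands for a later round or height. -/
lemma timer_persists (he : Effect sys p now rcv s s') {tm : Timer} (hst : s.started = true)
    (htm : tm ∈ s.timers) : tm ∈ s'.timers ∨ s'.Past tm.height tm.round (tm.kind.num + 1) := by
  cases he <;> simp_all only [LState.Past, castPrevote, castPrecommit, LState.broadcast, Phase.num,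
    true_and] <;> grind [Phase.num]

lemma timer_reason (he : Effect sys p now rcv s s') {tm : Timer} (htm : tm ∈ s'.timers)
    (hn : tm ∉ s.timers) : tm.deadline = now + par.timeout tm.kind tm.round ∧
      (tm.kind = Phase.prevote →
        2 * par.f + 1 ≤ sys.weight (prevoters s.log tm.height tm.round)) ∧
      (tm.kind = Phase.precommit →
        2 * par.f + 1 ≤ sys.weight (precommitters s.log tm.height tm.round)) := by
  cases he <;> simp_all only [castPrevote, castPrecommit, LState.broadcast] <;>
    grind [Params.timeout]

lemma prevote_reason (he : Effect sys p now rcv s s') {q : P} {h r : ℕ} {i : Option I}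
    (hm : Msg.prevote q h r i ∈ s'.sent) (hn : Msg.prevote q h r i ∉ s.sent) :
    s.height = h ∧ s.round = r ∧ s.step = Phase.propose ∧ s.started = true ∧
      PrevoteReason sys now s i := by
  cases he <;> simp_all only [castPrevote, castPrecommit, LState.broadcast] <;> grind

lemma precommit_reason (he : Effect sys p now rcv s s') {q : P} {h r : ℕ} {i : Option I}
    (hm : Msg.precommit q h r i ∈ s'.sent) (hn : Msg.precommit q h r i ∉ s.sent) :
    s.height = h ∧ s.round = r ∧ s.step = Phase.prevote ∧ s.started = true ∧
      PrecommitReason sys now s i := by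
  cases he <;> simp_all only [castPrevote, castPrecommit, LState.broadcast] <;> grind

lemma proposal_reason (he : Effect sys p now rcv s s') {q : P} {h r : ℕ} {v : V} {vr : ℤ}
    (hm : Msg.proposal q h r v vr ∈ s'.sent) (hn : Msg.proposal q h r v vr ∉ s.sent) :
    s'.height = h ∧ s'.round = r ∧ s'.started = true ∧ s'.validRound = vr := by
  cases he <;> simp_all only [castPrevote, castPrecommit, LState.broadcast] <;> grind

/-- A start or a decision leads to round `0`, so only a round skip or a precommit timeout can pass
round `r`. The bound on `h` is needed because after the last instance the round number keeps its old
value. -/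
lemma round_reason (he : Effect sys p now rcv s s') {h r : ℕ}
    (hm : s'.Past h (r + 1) 0) (hn : ¬ s.Past h (r + 1) 0) (hh : s'.height ≤ h)
    (hlt : (h : ℕ∞) < sys.heights) :
    (∃ r' > r, par.f + 1 ≤ sys.weight (senders s.log h r')) ∨
    ∃ d ≤ now, (⟨Phase.precommit, h, r, d⟩ : Timer) ∈ s.timers := by
  cases he with
  | advance log sent tms r' hs hr hsub hsent htm hlog hnew hnewtm hreason =>
    simp only [LState.Past, hs, true_and] at hm hn hh
    have h1 : s.height = h := by omega
    subst h1
    rcases hreason with hreason | ⟨h1, h2⟩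
    · exact Or.inl ⟨r', by omega, hreason⟩
    · have : r = s.round := by omega
      subst this
      exact Or.inr h2
  | begin log sent tms step r' b₁ b₂ b₃ hs hr =>
    simp only [LState.Past, true_and] at hm hh
    have h1 : s.height = h := by omega
    rcases hr with hr | hr
    · omega
    · exact absurd (h1 ▸ hlt) hr
  | decide _ hs hreason hs' hh' hlog hlog' hsent hnew htm hnewtm hdec hround hvr =>
    simp only [LState.Past, hs', true_and] at hm hh
    have h1 : s'.height = h := by omega
    rcases hround with hr | hr
    · omega
    · exact absurd (h1 ▸ hlt) hr
  | _ =>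
    exfalso
    simp only [LState.Past, castPrevote, castPrecommit, LState.broadcast] at hm hn hh
    grind

lemma decide_reason (he : Effect sys p now rcv s s') (hh : s.height < s'.height) :
    s'.height = s.height + 1 ∧ DecisionReason sys s ∧ s'.validRound = -1 := by
  cases he <;> simp_all [castPrevote, castPrecommit, LState.broadcast]

lemma valid_mono (he : Effect sys p now rcv s s') (H : Inv sys p s)
    (hh : s'.height = s.height) : s.validRound ≤ s'.validRound := by
  have h1 : s.validRound ≤ s.round := by
    rcases H.valid_spec with ⟨h, -⟩ | ⟨n, v, h, hn, -⟩ <;> omega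
  cases he <;> simp_all [castPrevote, castPrecommit, LState.broadcast]; grind

lemma lock_reason (he : Effect sys p now rcv s s') (hh : s'.height = s.height) :
    s'.lockedRound = s.lockedRound ∨ s'.lockedRound = s.round ∧ s.started = true ∧
      s.step = Phase.prevote ∧ s'.step = Phase.precommit ∧ s'.round = s.round ∧
      ∃ v vr, Msg.proposal (sys.proposer s.height s.round) s.height s.round v vr ∈ s.log ∧
        2 * par.f + 1 ≤ sys.weight (prevotersFor s.log s.height s.round (some (sys.idOf v))) ∧
        sys.valid v := by
  cases he with
  | precommit i tms vv lv vr lr b hs hstep hsub htm hreason hlock =>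
    rcases hlock with ⟨-, h⟩ | ⟨-, h, h'⟩
    · exact Or.inl h
    · exact Or.inr ⟨h, hs, hstep, rfl, rfl, h'⟩
  | decide => omega
  | _ => exact Or.inl rfl

end Effect

/-! ### Quorum arithmetic. -/

/-- Faulty processes contribute at most `f` and processes of power `0` nothing, so some correct
member of positive power remains. -/
lemma System.exists_mem_of_weight (sys : System par P V I) {faulty : Finset P}
    (hf : ∑ p ∈ faulty, sys.power p ≤ par.f) {A : Set P} (hA : par.f + 1 ≤ sys.weight A) :
    ∃ q ∈ A, q ∉ faulty ∧ 0 < sys.power q := by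
  classical
  by_contra! hne
  have : sys.weight A ≤ ∑ p ∈ faulty, sys.power p := by
    unfold System.weight
    rw [← Finset.sum_indicator_subset _ (Finset.subset_univ faulty)]
    refine Finset.sum_le_sum fun p _ => ?_
    by_cases hpA : p ∈ A
    · by_cases hpf : p ∈ faulty
      · simp [hpA, hpf]
      · simp [hpA, Nat.le_zero.1 (hne p hpA hpf)]
    · simp [hpA]
  omega

/-- Two quorums overlap in power at least `2 * (2f + 1) - (3f + 1) = f + 1`. -/
lemma System.exists_mem_inter_of_weight (sys : System par P V I) {faulty : Finset P}
    (hf : ∑ p ∈ faulty, sys.power p ≤ par.f) {A B : Set P} (hA : 2 * par.f + 1 ≤ sys.weight A)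
    (hB : 2 * par.f + 1 ≤ sys.weight B) :
    ∃ q, q ∈ A ∧ q ∈ B ∧ q ∉ faulty ∧ 0 < sys.power q := by
  classical
  have h : sys.weight A + sys.weight B ≤ par.n + sys.weight (A ∩ B) := by
    rw [← sys.power_total]
    unfold System.weight
    rw [← Finset.sum_add_distrib, ← Finset.sum_add_distrib]
    refine Finset.sum_le_sum fun p _ => ?_
    by_cases hpA : p ∈ A <;> by_cases hpB : p ∈ B <;> simp [hpA, hpB]
  obtain ⟨q, hq, h1, h2⟩ := sys.exists_mem_of_weight hf (A := A ∩ B) (by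
    unfold Params.n at h; omega)
  exact ⟨q, hq.1, hq.2, h1, h2⟩

/-- The correct processes of positive power alone carry at least `3f + 1 - f`. -/
lemma System.quorum_le_weight (sys : System par P V I) {faulty : Finset P}
    (hf : ∑ p ∈ faulty, sys.power p ≤ par.f) {A : Set P}
    (hA : ∀ q ∉ faulty, 0 < sys.power q → q ∈ A) : 2 * par.f + 1 ≤ sys.weight A := by
  classical
  have h : par.n ≤ sys.weight A + ∑ p ∈ faulty, sys.power p := by
    rw [← sys.power_total, ← Finset.sum_indicator_subset _ (Finset.subset_univ faulty)]
    unfold System.weight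
    rw [← Finset.sum_add_distrib]
    refine Finset.sum_le_sum fun p _ => ?_
    by_cases hpA : p ∈ A
    · simp [hpA]
    · by_cases hpf : p ∈ faulty
      · simp [hpf]
      · have := fun h => hpA (hA p hpf h)
        simp [Nat.le_zero.1 (not_lt.1 this)]
  unfold Params.n at h
  omega

/-! ### Histories of an execution. -/

/-- An event changes the state of one correct process at most and is idle for all others. Hence the
invariants hold for every process; faulty ones simply stay in their initial state. -/
lemma Event.localStep {sys : System par P V I} {faulty : Finset P} {now : ℝ}
    {c c' : P → LState P V I} (he : Event sys faulty now c c') (q : P) :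
    LocalStep sys q now (fun m => m.src ∉ faulty → m ∈ (c m.src).sent) (c q) (c' q) := by
  classical
  cases he with
  | idle => exact LocalStep.idle _
  | start p hp hs =>
    by_cases h : q = p
    · subst h; simpa using LocalStep.start _ hs
    · simpa [Function.update_of_ne h] using LocalStep.idle _
  | receive p m hp hm =>
    by_cases h : q = p
    · subst h; simpa using LocalStep.receive _ m hm
    · simpa [Function.update_of_ne h] using LocalStep.idle _
  | rule p s' hp ha hr =>
    by_cases h : q = p
    · subst h; simpa using LocalStep.rule _ _ ha hr
    · simpa [Function.update_of_ne h] using LocalStep.idle _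
  | timeout p tm hp htm hdue =>
    by_cases h : q = p
    · subst h; simpa using LocalStep.timeout _ tm htm hdue
    · simpa [Function.update_of_ne h] using LocalStep.idle _

/-- The first step at which a property that fails initially becomes true. -/
lemma exists_first_step {Q : ℕ → Prop} (h0 : ¬ Q 0) {k : ℕ} (hk : Q k) :
    ∃ j < k, ¬ Q j ∧ Q (j + 1) := by
  induction k with
  | zero => exact absurd hk h0
  | succ k ih =>
    by_cases h : Q k
    · obtain ⟨j, hj, h⟩ := ih h
      exact ⟨j, by omega, h⟩
    · exact ⟨k, by omega, h, hk⟩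

lemma monotone_prop {Q : ℕ → Prop} (h : ∀ k, Q k → Q (k + 1)) {k k' : ℕ} (hk : k ≤ k')
    (hQ : Q k) : Q k' := by
  induction hk with
  | refl => exact hQ
  | step _ ih => exact h _ ih

namespace Execution

variable {sys : System par P V I} {faulty : Finset P} {GST Δ : ℝ}
  (e : Execution sys faulty GST Δ)

lemma inv (p : P) (k : ℕ) : Inv sys p (e.state k p) := by
  induction k with
  | zero => rw [e.state_zero]; exact Inv.initial sys p
  | succ k ih => exact ih.localStep ((e.event k).localStep p)

lemma effect (p : P) (k : ℕ) :
    Effect sys p (e.time k) (fun m => m.src ∉ faulty → m ∈ (e.state k m.src).sent)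
      (e.state k p) (e.state (k + 1) p) :=
  ((e.event k).localStep p).effect (e.inv p k)

variable {e} {p : P} {k k' : ℕ}

lemma past_mono (hk : k ≤ k') {h r x : ℕ} (hp : (e.state k p).Past h r x) :
    (e.state k' p).Past h r x :=
  monotone_prop (Q := fun k => (e.state k p).Past h r x) (fun k => (e.effect p k).past_mono) hk hp

lemma height_mono (hk : k ≤ k') : (e.state k p).height ≤ (e.state k' p).height :=
  monotone_nat_of_le_succ (f := fun k => (e.state k p).height)
    (fun k => (e.effect p k).height_mono) hk

lemma sent_mono (hk : k ≤ k') {m : Msg P V I} (hm : m ∈ (e.state k p).sent) :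
    m ∈ (e.state k' p).sent :=
  monotone_prop (Q := fun k => m ∈ (e.state k p).sent) (fun k h => (e.effect p k).sent_mono h)
    hk hm

lemma log_mono (hk : k ≤ k') {m : Msg P V I} (hm : m ∈ (e.state k p).log)
    (hh : (e.state k' p).height ≤ m.height) : m ∈ (e.state k' p).log := by
  induction hk with
  | refl => exact hm
  | @step k' hk ih =>
    exact (e.effect p k').log_mono (ih ((height_mono (Nat.le_succ _)).trans hh)) hh

lemma started_mono (hk : k ≤ k') (hs : (e.state k p).started = true) :
    (e.state k' p).started = true := by
  have : (e.state k p).Past (e.state k p).height (e.state k p).round 0 := ⟨hs, by simp⟩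
  exact (past_mono hk this).1

lemma timer_persists (hk : k ≤ k') {tm : Timer} (htm : tm ∈ (e.state k p).timers) :
    tm ∈ (e.state k' p).timers ∨
      (e.state k' p).Past tm.height tm.round (tm.kind.num + 1) := by
  refine monotone_prop (Q := fun k => tm ∈ (e.state k p).timers ∨
      (e.state k p).Past tm.height tm.round (tm.kind.num + 1)) (fun k hQ => ?_) hk (Or.inl htm)
  rcases hQ with h | h
  · exact (e.effect p k).timer_persists ((e.inv p k).timer_past _ h).1 h
  · exact Or.inr ((e.effect p k).past_mono h)

lemma valid_mono (hk : k ≤ k') (hh : (e.state k' p).height = (e.state k p).height) :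
    (e.state k p).validRound ≤ (e.state k' p).validRound := by
  induction hk with
  | refl => exact le_rfl
  | @step k' hk ih =>
    have h1 := height_mono (e := e) (p := p) hk
    have h2 := height_mono (e := e) (p := p) (Nat.le_add_right k' 1)
    simp only [Nat.succ_eq_add_one] at hh ⊢
    exact (ih (by omega)).trans ((e.effect p k').valid_mono (e.inv p k') (by omega))

/-- Unforgeability: a logged message is the process's own broadcast or was received, and a correct
signature can be received only after sending. -/
lemma sent_of_log {m : Msg P V I} (hm : m ∈ (e.state k p).log) (hsrc : m.src ∉ faulty) :
    m ∈ (e.state k m.src).sent := by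
  induction k with
  | zero => simp [e.state_zero, LState.initial] at hm
  | succ k ih =>
    rcases (e.effect p k).log_source hm with h | h | h
    · exact sent_mono (Nat.le_succ _) (ih h)
    · rwa [(e.inv p (k + 1)).sent_src m h]
    · exact sent_mono (Nat.le_succ _) (h hsrc)

lemma past_of_log {m : Msg P V I} (hm : m ∈ (e.state k p).log) (hsrc : m.src ∉ faulty) :
    (e.state k m.src).Past m.height m.round m.num :=
  (e.inv _ k).sent_past m (sent_of_log hm hsrc)

lemma timer_reason {tm : Timer} (htm : tm ∈ (e.state k p).timers) :
    ∃ j < k, tm.deadline = e.time j + par.timeout tm.kind tm.round ∧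
      (e.state (j + 1) p).Past tm.height tm.round 0 ∧
      (tm.kind = Phase.prevote →
        2 * par.f + 1 ≤ sys.weight (prevoters (e.state j p).log tm.height tm.round)) ∧
      (tm.kind = Phase.precommit →
        2 * par.f + 1 ≤ sys.weight (precommitters (e.state j p).log tm.height tm.round)) := by
  obtain ⟨j, hj, h1, h2⟩ := exists_first_step (Q := fun k => tm ∈ (e.state k p).timers)
    (by simp [e.state_zero, LState.initial]) htm
  obtain ⟨h3, h4⟩ := (e.effect p j).timer_reason h2 h1
  have := (e.inv p (j + 1)).timer_past _ h2
  refine ⟨j, hj, h3, ⟨this.1, ?_⟩, h4⟩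
  have := this.2
  omega

lemma prevote_reason {q : P} {h r : ℕ} {i : Option I}
    (hm : Msg.prevote q h r i ∈ (e.state k p).sent) :
    ∃ j < k, (e.state j p).height = h ∧ (e.state j p).round = r ∧
      (e.state j p).step = Phase.propose ∧ (e.state j p).started = true ∧
      PrevoteReason sys (e.time j) (e.state j p) i := by
  obtain ⟨j, hj, h1, h2⟩ := exists_first_step
    (Q := fun k => Msg.prevote q h r i ∈ (e.state k p).sent)
    (by simp [e.state_zero, LState.initial]) hm
  exact ⟨j, hj, (e.effect p j).prevote_reason h2 h1⟩

lemma precommit_reason {q : P} {h r : ℕ} {i : Option I}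
    (hm : Msg.precommit q h r i ∈ (e.state k p).sent) :
    ∃ j < k, (e.state j p).height = h ∧ (e.state j p).round = r ∧
      (e.state j p).step = Phase.prevote ∧ (e.state j p).started = true ∧
      PrecommitReason sys (e.time j) (e.state j p) i := by
  obtain ⟨j, hj, h1, h2⟩ := exists_first_step
    (Q := fun k => Msg.precommit q h r i ∈ (e.state k p).sent)
    (by simp [e.state_zero, LState.initial]) hm
  exact ⟨j, hj, (e.effect p j).precommit_reason h2 h1⟩

/-- Unlike for votes, the state is the one after the sending step, because `StartRound` changes the
round and proposes in the same step; the valid round is already the proposed one. -/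
lemma proposal_reason {q : P} {h r : ℕ} {v : V} {vr : ℤ}
    (hm : Msg.proposal q h r v vr ∈ (e.state k p).sent) :
    ∃ j ≤ k, (e.state j p).height = h ∧ (e.state j p).round = r ∧
      (e.state j p).started = true ∧ (e.state j p).validRound = vr := by
  obtain ⟨j, hj, h1, h2⟩ := exists_first_step
    (Q := fun k => Msg.proposal q h r v vr ∈ (e.state k p).sent)
    (by simp [e.state_zero, LState.initial]) hm
  exact ⟨j + 1, hj, (e.effect p j).proposal_reason h2 h1⟩

/-- The locked round only changes to the current round of a step that locks. -/
lemma locked_eq_or_le (hk : k ≤ k') (hh : (e.state k' p).height = (e.state k p).height)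
    (hs : (e.state k p).started = true) :
    (e.state k' p).lockedRound = (e.state k p).lockedRound ∨
      ((e.state k p).round : ℤ) ≤ (e.state k' p).lockedRound := by
  induction hk with
  | refl => exact Or.inl rfl
  | @step k' hk ih =>
    have h1 := height_mono (e := e) (p := p) hk
    have h2 := height_mono (e := e) (p := p) (Nat.le_add_right k' 1)
    simp only [Nat.succ_eq_add_one] at hh ⊢
    have h3 : (e.state k' p).Past (e.state k p).height (e.state k p).round 0 :=
      past_mono hk ⟨hs, by simp⟩
    have h4 := h3.2
    rcases (e.effect p k').lock_reason (by omega) with h | ⟨h, -⟩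
    · rw [h]; exact ih (by omega)
    · right; omega

lemma lock_reason {h n : ℕ} (hk : (e.state k p).height = h)
    (hn : (e.state k p).lockedRound = n) :
    ∃ j < k, (e.state j p).height = h ∧ (e.state j p).round = n ∧
      (e.state j p).started = true ∧ (e.state j p).step = Phase.prevote ∧
      (e.state (j + 1) p).height = h ∧ (e.state (j + 1) p).round = n ∧
      (e.state (j + 1) p).step = Phase.precommit ∧
      ∃ v vr, Msg.proposal (sys.proposer h n) h n v vr ∈ (e.state j p).log ∧
        2 * par.f + 1 ≤
          sys.weight (prevotersFor (e.state j p).log h n (some (sys.idOf v))) ∧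
        sys.valid v := by
  obtain ⟨j, hj, h1, h2⟩ := exists_first_step
    (Q := fun k => (e.state k p).height = h ∧ (e.state k p).lockedRound = n)
    (by simp [e.state_zero, LState.initial]) ⟨hk, hn⟩
  have heff := e.effect p j
  by_cases hh : (e.state j p).height = h
  · rcases heff.lock_reason (h2.1.trans hh.symm) with h3 | ⟨h3, h4, h5, h6, h7, h8⟩
    · exact absurd ⟨hh, h3 ▸ h2.2⟩ h1
    · have hr : (e.state j p).round = n := by have := h2.2; omega
      rw [hh, hr] at h8
      exact ⟨j, hj, hh, hr, h4, h5, h2.1, h7.trans hr, h6, h8⟩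
  -- A change of height resets the valid round to `-1`, which bounds the locked round from above, so
  -- it cannot create the lock `n ≥ 0`.
  · exfalso
    have hlt : (e.state j p).height < (e.state (j + 1) p).height := by
      have := heff.height_mono
      have := h2.1
      omega
    have h3 := (heff.decide_reason hlt).2.2
    have h4 := (e.inv p (j + 1)).locked_le
    have h5 := h2.2
    omega

end Execution

end Tendermint

/-! ### Snapshots at real times and urgency. -/

namespace Tendermint

variable {par : Params} {P V I : Type*}

namespace LState.Past

variable {s : LState P V I} {h r x : ℕ}

lemma mono {r' x' : ℕ} (hs : s.Past h r x) (hle : r' < r ∨ r' = r ∧ x' ≤ x) : s.Past h r' x' := by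
  have := hs.2
  exact ⟨hs.1, by omega⟩

lemma succ_round (hs : s.Past h r 3) : s.Past h (r + 1) 0 := by
  have h1 := hs.2
  have h2 : s.step.num ≤ 2 := by cases s.step <;> simp [Phase.num]
  exact ⟨hs.1, by omega⟩

end LState.Past

lemma Params.timeout_nonneg (par : Params) (x : Phase) (r : ℕ) : 0 ≤ par.timeout x r := by
  have h1 := par.initPropose_nonneg
  have h2 := par.initPrevote_nonneg
  have h3 := par.initPrecommit_nonneg
  have h4 := par.timeoutDelta_pos
  cases x <;> simp only [timeout, timeoutPropose, timeoutPrevote, timeoutPrecommit] <;> positivity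

lemma Params.timeoutPropose_nonneg (par : Params) (r : ℕ) : 0 ≤ par.timeoutPropose r :=
  par.timeout_nonneg Phase.propose r

lemma Params.timeoutPrevote_nonneg (par : Params) (r : ℕ) : 0 ≤ par.timeoutPrevote r :=
  par.timeout_nonneg Phase.prevote r

lemma Params.timeoutPrecommit_nonneg (par : Params) (r : ℕ) : 0 ≤ par.timeoutPrecommit r :=
  par.timeout_nonneg Phase.precommit r

variable [Fintype P]

namespace Execution

variable {sys : System par P V I} {faulty : Finset P} {GST Δ : ℝ}
  (e : Execution sys faulty GST Δ)

lemma exists_time_gt (t : ℝ) : ∃ k, t < e.time k :=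
  (e.time_diverges.eventually_gt_atTop t).exists

open scoped Classical in
/-- The number of events that take place up to time `t`. -/
noncomputable def idx (t : ℝ) : ℕ := Nat.find (e.exists_time_gt t)

variable {e}

lemma lt_idx {k : ℕ} {t : ℝ} : k < e.idx t ↔ e.time k ≤ t := by
  classical
  constructor
  · intro h
    exact not_lt.1 (Nat.find_min (e.exists_time_gt t) h)
  · intro h
    by_contra hk
    have h1 : t < e.time (e.idx t) := Nat.find_spec (e.exists_time_gt t)
    have h2 := e.time_mono (not_lt.1 hk)
    linarith

lemma idx_mono {t t' : ℝ} (h : t ≤ t') : e.idx t ≤ e.idx t' := by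
  by_contra hlt
  have h1 := lt_idx.1 (not_le.1 hlt)
  have h2 : ¬ e.idx t' < e.idx t' := lt_irrefl _
  exact h2 (lt_idx.2 (h1.trans h))

variable (e) in
/-- The state of `p` after all events up to time `t`. -/
noncomputable abbrev snap (t : ℝ) (p : P) : LState P V I := e.state (e.idx t) p

variable {t : ℝ} {p : P}

/-- Right after a snapshot time advances strictly, which is the hypothesis of the urgency axioms.
Having started excludes index `0`, which no event precedes. -/
lemma idx_pos_of_started (hs : (e.snap t p).started = true) :
    ∃ k, e.idx t = k + 1 ∧ e.time k < e.time (k + 1) ∧ t < e.time (k + 1) := by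
  cases hk : e.idx t with
  | zero => simp [snap, hk, e.state_zero, LState.initial] at hs
  | succ k =>
    have h1 : e.time k ≤ t := lt_idx.1 (by omega)
    have h2 : t < e.time (k + 1) := by
      by_contra h
      have := lt_idx.2 (not_lt.1 h)
      omega
    exact ⟨k, rfl, h1.trans_lt h2, h2⟩

/-- The clock value is irrelevant to whether a rule applies; it only enters the deadlines that the
rule creates. -/
lemma not_rule_snap (hp : p ∉ faulty) (ha : Active sys (e.snap t p)) :
    ∃ now, ∀ s', ¬ Rule sys p now (e.snap t p) s' := by
  obtain ⟨k, hk, hlt, -⟩ := idx_pos_of_started ha.1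
  have := e.rules_urgent k hlt p hp (by rw [← hk]; exact ha)
  rw [← hk] at this
  exact ⟨_, fun s' hs' => this ⟨s', hs'⟩⟩

lemma lt_deadline (hp : p ∉ faulty) {tm : Timer} (htm : tm ∈ (e.snap t p).timers) :
    t < tm.deadline := by
  obtain ⟨k, hk, hlt, h⟩ := idx_pos_of_started ((e.inv p _).timer_past tm htm).1
  exact h.trans_le (e.timers_urgent k hlt p hp tm (by rw [← hk]; exact htm))

/-- The timer was scheduled no later than `t`, so its deadline is at most `t` plus the timeout, and
no snapshot keeps a timer that is due. -/
lemma timer_fires (hp : p ∉ faulty) {tm : Timer} (htm : tm ∈ (e.snap t p).timers) :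
    (e.snap (t + par.timeout tm.kind tm.round) p).Past tm.height tm.round (tm.kind.num + 1) := by
  have hle : t ≤ t + par.timeout tm.kind tm.round := by
    linarith [par.timeout_nonneg tm.kind tm.round]
  refine (timer_persists (idx_mono hle) htm).resolve_left fun h => ?_
  have h1 := lt_deadline hp h
  obtain ⟨j, hj, h2, -⟩ := timer_reason htm
  have h3 := lt_idx.1 hj
  linarith

section Urgency

variable (hp : p ∉ faulty) (ha : Active sys (e.snap t p))
include hp ha

/-- In this and the following lemmas the messages enabling a rule are present at a snapshot, so by
urgency one of its other guards must fail. -/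
lemma step_ne_propose_of_new {v : V}
    (hmsg : Msg.proposal (sys.proposer (e.snap t p).height (e.snap t p).round)
      (e.snap t p).height (e.snap t p).round v (-1) ∈ (e.snap t p).log) :
    (e.snap t p).step ≠ Phase.propose := fun hstep =>
  (not_rule_snap hp ha).elim fun _ h => h _ (Rule.newProposal _ v hmsg hstep)

lemma step_ne_propose_of_old {v : V} {vr : ℕ}
    (hmsg : Msg.proposal (sys.proposer (e.snap t p).height (e.snap t p).round)
      (e.snap t p).height (e.snap t p).round v (vr : ℤ) ∈ (e.snap t p).log)
    (hquorum : 2 * par.f + 1 ≤ sys.weight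
      (prevotersFor (e.snap t p).log (e.snap t p).height vr (some (sys.idOf v))))
    (hvr : vr < (e.snap t p).round) : (e.snap t p).step ≠ Phase.propose := fun hstep =>
  (not_rule_snap hp ha).elim fun _ h => h _ (Rule.oldProposal _ v vr hmsg hquorum hstep hvr)

lemma anyPrevotes_snap (hquorum : 2 * par.f + 1 ≤ sys.weight
      (prevoters (e.snap t p).log (e.snap t p).height (e.snap t p).round))
    (hstep : (e.snap t p).step = Phase.prevote) : (e.snap t p).anyPrevotesDone = true := by
  by_contra hfirst
  exact (not_rule_snap hp ha).elim fun _ h =>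
    h _ (Rule.anyPrevotes _ hquorum hstep (by simpa using hfirst))

lemma polka_snap {v : V} {vr : ℤ}
    (hmsg : Msg.proposal (sys.proposer (e.snap t p).height (e.snap t p).round)
      (e.snap t p).height (e.snap t p).round v vr ∈ (e.snap t p).log)
    (hquorum : 2 * par.f + 1 ≤ sys.weight (prevotersFor (e.snap t p).log
      (e.snap t p).height (e.snap t p).round (some (sys.idOf v))))
    (hvalid : sys.valid v) (hstep : (e.snap t p).step ≠ Phase.propose) :
    (e.snap t p).polkaDone = true := by
  by_contra hfirst
  refine (not_rule_snap hp ha).elim fun _ h =>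
    h _ (Rule.polka _ v vr hmsg hquorum hvalid ?_ (by simpa using hfirst))
  cases hs : (e.snap t p).step <;> simp_all

lemma anyPrecommits_snap (hquorum : 2 * par.f + 1 ≤ sys.weight
      (precommitters (e.snap t p).log (e.snap t p).height (e.snap t p).round)) :
    (e.snap t p).anyPrecommitsDone = true := by
  by_contra hfirst
  exact (not_rule_snap hp ha).elim fun _ h =>
    h _ (Rule.anyPrecommits _ hquorum (by simpa using hfirst))

lemma not_decision_snap : ¬ DecisionReason sys (e.snap t p) := by
  rintro ⟨r, v, vr, hmsg, hquorum, hvalid⟩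
  exact (not_rule_snap hp ha).elim fun _ h => h _ (Rule.decision _ r v vr hmsg hquorum
    (((e.inv p _).decided _).2 le_rfl) hvalid)

lemma le_round_snap {r : ℕ}
    (hquorum : par.f + 1 ≤ sys.weight (senders (e.snap t p).log (e.snap t p).height r)) :
    r ≤ (e.snap t p).round := by
  by_contra hr
  exact (not_rule_snap hp ha).elim fun _ h => h _ (Rule.skipRound _ r hquorum (not_le.1 hr))

end Urgency

lemma gossip_snap (hp : p ∉ faulty) {k : ℕ} {m : Msg P V I} (hm : m ∈ (e.state k p).log)
    (hk : k ≤ e.idx t) (ht : GST ≤ t) {q : P} (hq : q ∉ faulty)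
    (hh : (e.snap (t + Δ) q).height ≤ m.height) : m ∈ (e.snap (t + Δ) q).log := by
  cases k with
  | zero => simp [e.state_zero, LState.initial] at hm
  | succ k =>
    obtain ⟨j, hj, hmj⟩ := e.gossip k p hp m hm q hq
    have h1 : e.time k ≤ t := lt_idx.1 hk
    have h2 : e.time j ≤ t + Δ := by
      have := max_le h1 ht
      linarith
    exact log_mono (lt_idx.2 h2) hmj hh

end Execution

/-! ### A window of time in which no correct process leaves the height. -/

namespace Execution

variable {sys : System par P V I} {faulty : Finset P} {GST Δ : ℝ}

/-- From time `T` on all correct processes have reached height `h`, and none of them leaves it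
until time `T'`. -/
structure Window (e : Execution sys faulty GST Δ) (h : ℕ) (T T' : ℝ) : Prop where
  faulty_le : ∑ p ∈ faulty, sys.power p ≤ par.f
  delta_pos : 0 < Δ
  gst_le : GST ≤ T
  height_lt : (h : ℕ∞) < sys.heights
  reached : ∀ p ∉ faulty, (e.snap T p).Past h 0 0
  undecided : ∀ p ∉ faulty, (e.snap T' p).height ≤ h

/-- Some correct process has entered round `r` of height `h`. -/
def Entered (e : Execution sys faulty GST Δ) (h r k : ℕ) : Prop :=
  ∃ p ∉ faulty, (e.state k p).Past h r 0

/-- The property `Q` becomes true at time `τ`. -/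
def FirstTime (e : Execution sys faulty GST Δ) (Q : ℕ → Prop) (τ : ℝ) : Prop :=
  ∃ k, e.time k = τ ∧ ¬ Q k ∧ Q (k + 1)

variable {e : Execution sys faulty GST Δ} {h : ℕ} {T T' : ℝ}

lemma Entered.mono {r k k' : ℕ} (hk : k ≤ k') (H : e.Entered h r k) : e.Entered h r k' :=
  let ⟨p, hp, hpast⟩ := H
  ⟨p, hp, past_mono hk hpast⟩

lemma Entered.of_past {r x k : ℕ} {p : P} (hp : p ∉ faulty) (hpast : (e.state k p).Past h r x) :
    e.Entered h r k := ⟨p, hp, hpast.mono (by omega)⟩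

namespace FirstTime

variable {Q : ℕ → Prop} {τ : ℝ}

lemma of_idx (h0 : ¬ Q 0) {t : ℝ} (ht : Q (e.idx t)) : ∃ τ ≤ t, e.FirstTime Q τ :=
  let ⟨j, hj, h1, h2⟩ := exists_first_step h0 ht
  ⟨e.time j, lt_idx.1 hj, j, rfl, h1, h2⟩

variable (H : e.FirstTime Q τ) (hQ : ∀ {k k'}, k ≤ k' → Q k → Q k')
include H hQ

lemma le_time_of_succ {j : ℕ} (hj : Q (j + 1)) : τ ≤ e.time j := by
  obtain ⟨k, rfl, h1, h2⟩ := H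
  refine e.time_mono (not_lt.1 fun hlt => h1 (hQ hlt hj))

lemma le_time {j : ℕ} (hj : Q j) : τ ≤ e.time j :=
  H.le_time_of_succ hQ (hQ (Nat.le_succ j) hj)

lemma le_of_idx {t : ℝ} (ht : Q (e.idx t)) : τ ≤ t := by
  obtain ⟨k, rfl, h1, h2⟩ := H
  exact lt_idx.1 (not_le.1 fun hle => h1 (hQ hle ht))

lemma idx {t : ℝ} (ht : τ ≤ t) : Q (e.idx t) := by
  obtain ⟨k, rfl, h1, h2⟩ := H
  exact hQ (lt_idx.2 ht) h2

end FirstTime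

namespace Window

variable (W : e.Window h T T') {p q : P} {t : ℝ}
include W

lemma height_le {k : ℕ} (hp : p ∉ faulty) (hk : k ≤ e.idx T') : (e.state k p).height ≤ h :=
  (height_mono hk).trans (W.undecided p hp)

lemma past_zero (hp : p ∉ faulty) (ht : T ≤ t) : (e.snap t p).Past h 0 0 :=
  past_mono (idx_mono ht) (W.reached p hp)

lemma height_eq (hp : p ∉ faulty) (ht : T ≤ t) (ht' : t ≤ T') : (e.snap t p).height = h := by
  have h1 := (W.past_zero hp ht).2
  have h2 : (e.snap t p).height ≤ h := W.height_le hp (idx_mono ht')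
  omega

lemma active (hp : p ∉ faulty) (ht : T ≤ t) (ht' : t ≤ T') : Active sys (e.snap t p) :=
  ⟨(W.past_zero hp ht).1, by rw [W.height_eq hp ht ht']; exact W.height_lt⟩

lemma run (hp : p ∉ faulty) (ht : T ≤ t) (ht' : t ≤ T') : RunInv sys p (e.snap t p) :=
  (e.inv p _).run (W.active hp ht ht')

/-- A process in round `r` at least is in round `r`, or some process has entered round `r + 1`. -/
lemma round_eq {r x : ℕ} (hp : p ∉ faulty) (ht : T ≤ t) (ht' : t ≤ T')
    (hpast : (e.snap t p).Past h r x) (hn : ¬ e.Entered h (r + 1) (e.idx t)) :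
    (e.snap t p).round = r ∧ x ≤ (e.snap t p).step.num := by
  have h1 := W.height_eq hp ht ht'
  have h2 := hpast.2
  have h3 : ¬ (e.snap t p).Past h (r + 1) 0 := fun h => hn ⟨p, hp, h⟩
  simp only [LState.Past, hpast.1, true_and, not_or, not_and] at h3
  omega

lemma gossip {k : ℕ} {m : Msg P V I} (hp : p ∉ faulty) (hm : m ∈ (e.state k p).log)
    (hh : m.height = h) (hk : k ≤ e.idx t) (ht : T ≤ t) (ht' : t + Δ ≤ T') (hq : q ∉ faulty) :
    m ∈ (e.snap (t + Δ) q).log := by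
  have h1 := W.delta_pos
  exact gossip_snap hp hm hk (W.gst_le.trans ht) hq
    (by rw [W.height_eq hq (by linarith) ht', hh])

lemma gossip_sent {k : ℕ} {m : Msg P V I} (hp : p ∉ faulty) (hm : m ∈ (e.state k p).sent)
    (hh : m.height = h) (hk : k ≤ e.idx t) (ht : T ≤ t) (ht' : t + Δ ≤ T') (hq : q ∉ faulty) :
    m ∈ (e.snap (t + Δ) q).log := by
  have h1 := W.delta_pos
  refine W.gossip hp ((e.inv p k).sent_log m hm ?_) hh hk ht ht' hq
  rw [hh]
  exact W.height_le hp (hk.trans (idx_mono (by linarith)))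

lemma prevoted {r : ℕ} (hp : p ∉ faulty) (ht : T ≤ t) (ht' : t ≤ T')
    (hr : (e.snap t p).round = r) (hstep : 1 ≤ (e.snap t p).step.num) :
    ∃ i, Msg.prevote p h r i ∈ (e.snap t p).sent := by
  have := (W.run hp ht ht').has_prevote (by intro h; simp [h, Phase.num] at hstep)
  rwa [W.height_eq hp ht ht', hr] at this

lemma precommitted {r : ℕ} (hp : p ∉ faulty) (ht : T ≤ t) (ht' : t ≤ T')
    (hr : (e.snap t p).round = r) (hstep : 2 ≤ (e.snap t p).step.num) :
    ∃ i, Msg.precommit p h r i ∈ (e.snap t p).sent := by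
  have := (W.run hp ht ht').has_precommit
    (by cases h : (e.snap t p).step <;> simp [h, Phase.num] at hstep ⊢)
  rwa [W.height_eq hp ht ht', hr] at this

/-- A proposer has left the step `propose`. -/
lemma proposer_step {r : ℕ} (hp : p ∉ faulty) (ht : T ≤ t) (ht' : t ≤ T')
    (hr : (e.snap t p).round = r) (hprop : sys.proposer h r = p) :
    (e.snap t p).step ≠ Phase.propose := by
  have hh := W.height_eq hp ht ht'
  obtain ⟨v, vr, vv, hm, hv, hvv, hsp⟩ := (W.run hp ht ht').has_proposal (by rw [hh, hr, hprop])
  have hlog := (e.inv p _).sent_log _ hm le_rfl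
  have hprop' : sys.proposer (e.snap t p).height (e.snap t p).round = p := by rw [hh, hr, hprop]
  rcases hsp with ⟨rfl, -⟩ | ⟨n, v', rfl, hn, rfl, -, hq⟩
  · exact step_ne_propose_of_new hp (W.active hp ht ht') (v := v) (by rw [hprop']; exact hlog)
  · obtain rfl : v' = v := by simpa using hvv
    exact step_ne_propose_of_old hp (W.active hp ht ht') (v := v') (vr := n)
      (by rw [hprop']; exact hlog) hq hn

/-- In step `propose` a proposer would vote on its own proposal at once, and any other process has a
pending propose timer. -/
lemma past_prevote {r : ℕ} (hp : p ∉ faulty) (ht : T ≤ t)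
    (ht' : t ≤ T') (hpast : (e.snap t p).Past h r 0) :
    (e.snap (t + par.timeoutPropose r) p).Past h r 1 := by
  have hle : t ≤ t + par.timeoutPropose r := by
    linarith [par.timeoutPropose_nonneg r]
  by_cases h1 : (e.snap t p).Past h r 1
  · exact past_mono (idx_mono hle) h1
  have hh := W.height_eq hp ht ht'
  have h2 := hpast.2
  simp only [LState.Past, hpast.1, true_and, not_or, not_and] at h1
  have hr : (e.snap t p).round = r := by omega
  have hstep : (e.snap t p).step = Phase.propose := by
    have : (e.snap t p).step.num = 0 := by omega
    cases hs : (e.snap t p).step <;> simp [hs, Phase.num] at this ⊢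
  by_cases hprop : sys.proposer h r = p
  · exact absurd hstep (W.proposer_step hp ht ht' hr hprop)
  · obtain ⟨d, hd⟩ := (W.run hp ht ht').propose_timer hstep (by rwa [hh, hr])
    rw [hh, hr] at hd
    exact timer_fires hp hd

lemma past_precommit {r : ℕ} (hp : p ∉ faulty) (ht : T ≤ t)
    (ht' : t ≤ T') (hpast : (e.snap t p).Past h r 1)
    (hquorum : 2 * par.f + 1 ≤ sys.weight (prevoters (e.snap t p).log h r)) :
    (e.snap (t + par.timeoutPrevote r) p).Past h r 2 := by
  have hle : t ≤ t + par.timeoutPrevote r := by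
    linarith [par.timeoutPrevote_nonneg r]
  by_cases h1 : (e.snap t p).Past h r 2
  · exact past_mono (idx_mono hle) h1
  have hh := W.height_eq hp ht ht'
  have h2 := hpast.2
  simp only [LState.Past, hpast.1, true_and, not_or, not_and] at h1
  have hr : (e.snap t p).round = r := by omega
  have hstep : (e.snap t p).step = Phase.prevote := by
    have : (e.snap t p).step.num = 1 := by omega
    cases hs : (e.snap t p).step <;> simp [hs, Phase.num] at this ⊢
  have hdone := anyPrevotes_snap hp (W.active hp ht ht') (by rwa [hh, hr]) hstep
  rcases ((W.run hp ht ht').prevote_timer hdone).2 with h3 | ⟨d, hd⟩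
  · simp [hstep] at h3
  · rw [hh, hr] at hd
    exact timer_fires hp hd

/-- A quorum contains in particular the `f + 1` senders that trigger a round skip. -/
lemma past_of_precommitters {r : ℕ} (hp : p ∉ faulty) (ht : T ≤ t) (ht' : t ≤ T')
    (hquorum : 2 * par.f + 1 ≤ sys.weight (precommitters (e.snap t p).log h r)) :
    (e.snap t p).Past h r 0 := by
  have hh := W.height_eq hp ht ht'
  have h1 := le_round_snap hp (W.active hp ht ht') (r := r) (by
    rw [hh]
    have : precommitters (e.snap t p).log h r ⊆ senders (e.snap t p).log h r :=
      fun q ⟨i, hi⟩ => ⟨_, hi, rfl, rfl, rfl⟩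
    have := sys.weight_mono this
    omega)
  refine ⟨(W.active hp ht ht').1, Or.inr ⟨hh, ?_⟩⟩
  omega

/-- The quorum first pulls the process into round `r` if it is behind. There the precommit timeout
is already scheduled, and its expiry leads on. -/
lemma past_succ {r : ℕ} (hp : p ∉ faulty) (ht : T ≤ t) (ht' : t ≤ T')
    (hquorum : 2 * par.f + 1 ≤ sys.weight (precommitters (e.snap t p).log h r)) :
    (e.snap (t + par.timeoutPrecommit r) p).Past h (r + 1) 0 := by
  have hle : t ≤ t + par.timeoutPrecommit r := by
    linarith [par.timeoutPrecommit_nonneg r]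
  have hpast := W.past_of_precommitters hp ht ht' hquorum
  by_cases h1 : (e.snap t p).Past h (r + 1) 0
  · exact past_mono (idx_mono hle) h1
  have hh := W.height_eq hp ht ht'
  have h2 := hpast.2
  simp only [LState.Past, hpast.1, true_and, not_or, not_and] at h1
  have hr : (e.snap t p).round = r := by omega
  have hdone := anyPrecommits_snap hp (W.active hp ht ht') (by rwa [hh, hr])
  obtain ⟨d, hd⟩ := (W.run hp ht ht').precommit_timer hdone
  rw [hh, hr] at hd
  exact (timer_fires hp hd).succ_round

lemma prevotersFor_gossip {r k : ℕ} {i : Option I} (hp : p ∉ faulty)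
    (hquorum : 2 * par.f + 1 ≤ sys.weight (prevotersFor (e.state k p).log h r i))
    (hk : k ≤ e.idx t) (ht : T ≤ t) (ht' : t + Δ ≤ T') (hq : q ∉ faulty) :
    2 * par.f + 1 ≤ sys.weight (prevotersFor (e.snap (t + Δ) q).log h r i) :=
  hquorum.trans (sys.weight_mono (prevotersFor_mono fun _ hm hh =>
    W.gossip hp hm hh hk ht ht' hq))

lemma precommitters_gossip {r k : ℕ} (hp : p ∉ faulty)
    (hquorum : 2 * par.f + 1 ≤ sys.weight (precommitters (e.state k p).log h r))
    (hk : k ≤ e.idx t) (ht : T ≤ t) (ht' : t + Δ ≤ T') (hq : q ∉ faulty) :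
    2 * par.f + 1 ≤ sys.weight (precommitters (e.snap (t + Δ) q).log h r) :=
  hquorum.trans (sys.weight_mono (precommitters_mono fun _ hm hh =>
    W.gossip hp hm hh hk ht ht' hq))

lemma prevoters_of_all {r : ℕ} (ht : T ≤ t) (ht' : t + Δ ≤ T')
    (hall : ∀ p ∉ faulty, ∃ i, Msg.prevote p h r i ∈ (e.snap t p).sent) (hq : q ∉ faulty) :
    2 * par.f + 1 ≤ sys.weight (prevoters (e.snap (t + Δ) q).log h r) := by
  refine sys.quorum_le_weight W.faulty_le fun p hp _ => ?_
  obtain ⟨i, hi⟩ := hall p hp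
  exact ⟨i, W.gossip_sent hp hi rfl le_rfl ht ht' hq⟩

lemma precommitters_of_all {r : ℕ} (ht : T ≤ t) (ht' : t + Δ ≤ T')
    (hall : ∀ p ∉ faulty, ∃ i, Msg.precommit p h r i ∈ (e.snap t p).sent) (hq : q ∉ faulty) :
    2 * par.f + 1 ≤ sys.weight (precommitters (e.snap (t + Δ) q).log h r) := by
  refine sys.quorum_le_weight W.faulty_le fun p hp _ => ?_
  obtain ⟨i, hi⟩ := hall p hp
  exact ⟨i, W.gossip_sent hp hi rfl le_rfl ht ht' hq⟩

/-- The first process that enters a round does so after its timeout in the previous round. -/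
lemma entered_succ_reason {r k : ℕ} (hk : k < e.idx T') (hn : ¬ e.Entered h (r + 1) k)
    (hs : e.Entered h (r + 1) (k + 1)) :
    ∃ p ∉ faulty, ∃ j < k, e.time j + par.timeoutPrecommit r ≤ e.time k ∧
      2 * par.f + 1 ≤ sys.weight (precommitters (e.state j p).log h r) := by
  obtain ⟨p, hp, hpast⟩ := hs
  rcases (e.effect p k).round_reason hpast (fun h => hn ⟨p, hp, h⟩) (W.height_le hp hk)
    W.height_lt with ⟨r', hr', hquorum⟩ | ⟨d, hd, htm⟩
  -- A skip needs a message of a correct process that is already in a round beyond `r`, so it cannot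
  -- produce the first entry.
  · obtain ⟨q, ⟨m, hm, rfl, hh, hr⟩, hq, -⟩ := sys.exists_mem_of_weight W.faulty_le hquorum
    have := past_of_log hm hq
    exact absurd ⟨_, hq, this.mono (r' := r + 1) (x' := 0) (by omega)⟩ (hh ▸ hn)
  · obtain ⟨j, hj, h1, -, -, h2⟩ := timer_reason htm
    refine ⟨p, hp, j, hj, ?_, h2 rfl⟩
    simp only [Params.timeout] at h1
    linarith

end Window

end Execution

/-! ### Progress through the rounds. -/

/-- The time after which some correct process has entered round `r`. -/
noncomputable def Params.reachBound (par : Params) (Δ : ℝ) : ℕ → ℝ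
  | 0 => 0
  | r + 1 => par.reachBound Δ r +
      -- One `Δ` and one precommit timeout bring all processes into round `r`; the rest is the
      -- length of a full round run by timeouts only.
      (par.timeoutPropose r + par.timeoutPrevote r + 2 * par.timeoutPrecommit r + 3 * Δ)

lemma Params.reachBound_mono (par : Params) {Δ : ℝ} (hΔ : 0 < Δ) : Monotone (par.reachBound Δ) := by
  refine monotone_nat_of_le_succ fun r => ?_
  have h1 := par.timeoutPropose_nonneg r
  have h2 := par.timeoutPrevote_nonneg r
  have h3 := par.timeoutPrecommit_nonneg r
  rw [reachBound]
  linarith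

lemma Params.timeoutPrecommit_mono (par : Params) (r : ℕ) :
    par.timeoutPrecommit r ≤ par.timeoutPrecommit (r + 1) := by
  have := par.timeoutDelta_pos
  unfold timeoutPrecommit
  push_cast
  linarith

namespace Execution

variable {sys : System par P V I} {faulty : Finset P} {GST Δ : ℝ}
  {e : Execution sys faulty GST Δ} {h : ℕ} {T T' : ℝ}

lemma not_entered_zero (e : Execution sys faulty GST Δ) (h r : ℕ) : ¬ e.Entered h r 0 := by
  rintro ⟨p, -, hp⟩
  simpa [e.state_zero, LState.initial] using hp.1

namespace Window

variable (W : e.Window h T T') {p q : P} {t : ℝ}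
include W

lemma exists_correct : ∃ p ∉ faulty, 0 < sys.power p := by
  obtain ⟨q, -, hq⟩ := sys.exists_mem_of_weight W.faulty_le (A := Set.univ) (by
    have := sys.quorum_le_weight W.faulty_le (A := Set.univ) fun _ _ _ => trivial
    omega)
  exact ⟨q, hq⟩

/-- If nobody left round `r`, everybody would prevote by the propose timeout, see a quorum of
prevotes `Δ` later, precommit by the prevote timeout, see a quorum of precommits `Δ` later, and
leave by the precommit timeout. -/
lemma entered_succ {r : ℕ} (ht : T ≤ t)
    (ht' : t + par.timeoutPropose r + Δ + par.timeoutPrevote r + Δ + par.timeoutPrecommit r ≤ T')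
    (hall : ∀ p ∉ faulty, (e.snap t p).Past h r 0) :
    e.Entered h (r + 1) (e.idx (t + par.timeoutPropose r + Δ + par.timeoutPrevote r + Δ +
      par.timeoutPrecommit r)) := by
  by_contra hn
  have hΔ := W.delta_pos
  have h1 := par.timeoutPropose_nonneg r
  have h2 := par.timeoutPrevote_nonneg r
  have h3 := par.timeoutPrecommit_nonneg r
  obtain ⟨p₀, hp₀, -⟩ := W.exists_correct
  have hq1 : ∀ p ∉ faulty, 2 * par.f + 1 ≤
      sys.weight (prevoters (e.snap (t + par.timeoutPropose r + Δ) p).log h r) := by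
    intro p hp
    refine W.prevoters_of_all (by linarith) (by linarith) (fun q hq => ?_) hp
    obtain ⟨h4, h5⟩ := W.round_eq hq (by linarith) (by linarith)
      (W.past_prevote hq ht (by linarith) (hall q hq))
      (fun h => hn (h.mono (idx_mono (by linarith))))
    exact W.prevoted hq (by linarith) (by linarith) h4 h5
  have hq2 : 2 * par.f + 1 ≤ sys.weight (precommitters
      (e.snap (t + par.timeoutPropose r + Δ + par.timeoutPrevote r + Δ) p₀).log h r) := by
    refine W.precommitters_of_all (by linarith) (by linarith) (fun q hq => ?_) hp₀
    obtain ⟨h4, h5⟩ := W.round_eq hq (by linarith) (by linarith)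
      (W.past_precommit hq (by linarith) (by linarith) (past_mono (idx_mono (by linarith))
        (W.past_prevote hq ht (by linarith) (hall q hq))) (hq1 q hq))
      (fun h => hn (h.mono (idx_mono (by linarith))))
    exact W.precommitted hq (by linarith) (by linarith) h4 h5
  exact hn ⟨p₀, hp₀, W.past_succ hp₀ (by linarith) (by linarith) hq2⟩

/-- All correct processes follow the first one into a round. -/
lemma all_entered {r : ℕ} {τ : ℝ} (hτ : e.FirstTime (e.Entered h (r + 1)) τ) (ht : T ≤ t)
    (hle : τ ≤ t + par.timeoutPrecommit r) (ht' : t + Δ + par.timeoutPrecommit r ≤ T') :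
    ∀ p ∉ faulty, (e.snap (t + Δ + par.timeoutPrecommit r) p).Past h (r + 1) 0 := by
  intro q hq
  have hΔ := W.delta_pos
  have h3 := par.timeoutPrecommit_nonneg r
  obtain ⟨k, rfl, hn, hs⟩ := hτ
  obtain ⟨p, hp, j, hj, hjk, hquorum⟩ :=
    W.entered_succ_reason (lt_idx.2 (by linarith)) hn hs
  have hjt : j < e.idx t := lt_idx.2 (by linarith)
  exact W.past_succ hq (by linarith) (by linarith)
    (W.precommitters_gossip hp hquorum hjt.le ht (by linarith) hq)

/-- Induction on the round: once one process is in round `r`, `all_entered` brings in the others and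
`entered_succ` pushes someone onward. Round `0` needs no such catching up. -/
lemma entered_of_bound : ∀ {r : ℕ}, T + par.reachBound Δ r ≤ T' →
    e.Entered h r (e.idx (T + par.reachBound Δ r))
  | 0, _ => by
    obtain ⟨p, hp, -⟩ := W.exists_correct
    exact ⟨p, hp, W.past_zero hp (by simp [Params.reachBound])⟩
  | r + 1, hr => by
    have hΔ := W.delta_pos
    have h1 := par.timeoutPropose_nonneg r
    have h2 := par.timeoutPrevote_nonneg r
    have h3 := par.timeoutPrecommit_nonneg r
    have h0 : 0 ≤ par.reachBound Δ r := par.reachBound_mono hΔ (Nat.zero_le r)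
    rw [Params.reachBound] at hr
    have ih := entered_of_bound (r := r) (by linarith)
    have hall : ∀ p ∉ faulty,
        (e.snap (T + par.reachBound Δ r + Δ + par.timeoutPrecommit r) p).Past h r 0 := by
      cases r with
      | zero => exact fun p hp => W.past_zero hp (by linarith)
      | succ r =>
        intro p hp
        obtain ⟨τ, hτ, hfirst⟩ := FirstTime.of_idx (e.not_entered_zero h (r + 1)) ih
        have h4 := par.timeoutPrecommit_mono r
        have h5 := par.timeoutPrecommit_nonneg r
        exact past_mono (idx_mono (by linarith))
          (W.all_entered hfirst (t := T + par.reachBound Δ (r + 1)) (by linarith) (by linarith)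
            (by linarith) p hp)
    have := W.entered_succ (by linarith) (by linarith) hall
    refine this.mono (idx_mono ?_)
    rw [Params.reachBound]
    linarith

/-- A process leaves a round only after a timeout that follows some precommit. -/
lemma precommit_of_entered {r : ℕ} (ht : t ≤ T') (hr : e.Entered h (r + 1) (e.idx t)) :
    ∃ j, e.time j + par.timeoutPrecommit r ≤ t ∧
      ∃ q ∉ faulty, ∃ i, Msg.precommit q h r i ∈ (e.state j q).sent := by
  obtain ⟨τ, hτ, k, rfl, hn, hs⟩ := FirstTime.of_idx (e.not_entered_zero h (r + 1)) hr
  obtain ⟨p, hp, j, hj, hjk, hquorum⟩ :=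
    W.entered_succ_reason (lt_idx.2 (hτ.trans ht)) hn hs
  obtain ⟨q, ⟨i, hi⟩, hq, -⟩ := sys.exists_mem_of_weight W.faulty_le
    (A := precommitters (e.state j p).log h r) (by omega)
  exact ⟨j, by linarith, q, hq, i, sent_of_log hi hq⟩

end Window

/-! ### Synchronous rounds. -/

/-- Round `r` of height `h` is entered by all correct processes in the interval `[τ, τ + Δ]`, and
its timeouts are long. -/
structure Sync (e : Execution sys faulty GST Δ) (h r : ℕ) (T τ : ℝ) : Prop where
  first : e.FirstTime (e.Entered h r) τ
  le : T ≤ τ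
  all : ∀ p ∉ faulty, (e.snap (τ + Δ) p).Past h r 0
  -- The estimates inside such a round use delays of at most `4 * Δ`; the factor `10` is a generous
  -- margin.
  long : 10 * Δ ≤ r * par.timeoutDelta

namespace Sync

variable {r : ℕ} {τ : ℝ} (S : e.Sync h r T τ)
include S

lemma propose_long : 10 * Δ ≤ par.timeoutPropose r := by
  have h1 := S.long
  have h2 := par.initPropose_nonneg
  unfold Params.timeoutPropose
  linarith

lemma prevote_long : 10 * Δ ≤ par.timeoutPrevote r := by
  have h1 := S.long
  have h2 := par.initPrevote_nonneg
  unfold Params.timeoutPrevote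
  linarith

lemma precommit_long : 10 * Δ ≤ par.timeoutPrecommit r := by
  have h1 := S.long
  have h2 := par.initPrecommit_nonneg
  unfold Params.timeoutPrecommit
  linarith

lemma le_time {x j : ℕ} {p : P} (hp : p ∉ faulty) (hpast : (e.state (j + 1) p).Past h r x) :
    τ ≤ e.time j :=
  S.first.le_time_of_succ Entered.mono (Entered.of_past hp hpast)

lemma le_time_of_sent {j : ℕ} {m : Msg P V I} {p : P} (hp : p ∉ faulty)
    (hm : m ∈ (e.state j p).sent) (hh : m.height = h) (hr : m.round = r) : τ ≤ e.time j := by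
  have := (e.inv p j).sent_past m hm
  rw [hh, hr] at this
  exact S.le_time hp (past_mono (Nat.le_succ j) this)

/-- Leaving the round takes a full precommit timeout after some correct precommit of the round,
which is sent no earlier than `τ`. -/
lemma not_entered (W : e.Window h T T') {t : ℝ} (ht : t ≤ T')
    (hlt : t < τ + par.timeoutPrecommit r) : ¬ e.Entered h (r + 1) (e.idx t) := by
  intro hr
  obtain ⟨j, hj, q, hq, i, hi⟩ := W.precommit_of_entered ht hr
  have := S.le_time_of_sent hq hi rfl rfl
  linarith

end Sync

namespace Window

variable (W : e.Window h T T')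
include W

/-- The requirement `r₀ + 2 ≤ r` ensures that the precommits of round `r - 1` that lead into round
`r` come from a round above `r₀`, hence were sent at or after `T`. Gossip and the precommit timers
can then be analysed inside the window. -/
lemma exists_sync {r₀ r : ℕ} (hr₀ : ¬ e.Entered h (r₀ + 1) (e.idx T)) (hr : r₀ + 2 ≤ r)
    (hlong : 10 * Δ ≤ r * par.timeoutDelta) (hT : T + par.reachBound Δ r + Δ ≤ T') :
    ∃ τ ≤ T + par.reachBound Δ r, e.Sync h r T τ := by
  have hΔ := W.delta_pos
  obtain ⟨r, rfl⟩ : ∃ r', r = r' + 1 := ⟨r - 1, by omega⟩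
  obtain ⟨τ, hτ, hfirst⟩ := FirstTime.of_idx (e.not_entered_zero h (r + 1))
    (W.entered_of_bound (r := r + 1) (by linarith))
  obtain ⟨j, hjk, q, hq, i, hi⟩ := W.precommit_of_entered (by linarith)
    (hfirst.idx Entered.mono le_rfl)
  have hpast := (e.inv q j).sent_past _ hi
  have hTj : T ≤ e.time j := by
    by_contra hlt
    exact hr₀ (Entered.mono (lt_idx.2 (not_le.1 hlt).le).le
      (Entered.of_past hq (hpast.mono (r' := r₀ + 1) (x' := 0) (by
        simp only [Msg.round]; omega))))
  have h3 := par.timeoutPrecommit_nonneg r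
  refine ⟨τ, hτ, hfirst, by linarith, fun x hx => ?_, hlong⟩
  -- Starting one precommit timeout before `τ` makes the conclusion fall exactly at `τ + Δ`.
  have := W.all_entered hfirst (t := τ - par.timeoutPrecommit r) (by linarith) (by linarith)
    (by linarith) x hx
  rwa [show τ - par.timeoutPrecommit r + Δ + par.timeoutPrecommit r = τ + Δ by ring] at this

end Window

end Execution

/-! ### A lock in a synchronous round reaches every valid round. -/

namespace Execution

variable {sys : System par P V I} {faulty : Finset P} {GST Δ : ℝ}
  {e : Execution sys faulty GST Δ} {h : ℕ} {T T' : ℝ}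

/-- A proposal for a valid value together with a quorum of prevotes for it. -/
def Polka (sys : System par P V I) (h r : ℕ) (log : Set (Msg P V I)) : Prop :=
  ∃ v vr, Msg.proposal (sys.proposer h r) h r v vr ∈ log ∧
    2 * par.f + 1 ≤ sys.weight (prevotersFor log h r (some (sys.idOf v))) ∧ sys.valid v

/-- Some correct process has sent a prevote in round `r` of height `h`. -/
def Prevoted (e : Execution sys faulty GST Δ) (h r k : ℕ) : Prop :=
  ∃ p ∉ faulty, ∃ i, Msg.prevote p h r i ∈ (e.state k p).sent

/-- Some correct process has sent a precommit in round `r` of height `h`. -/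
def Precommitted (e : Execution sys faulty GST Δ) (h r k : ℕ) : Prop :=
  ∃ p ∉ faulty, ∃ i, Msg.precommit p h r i ∈ (e.state k p).sent

lemma Prevoted.mono {r k k' : ℕ} (hk : k ≤ k') (H : e.Prevoted h r k) : e.Prevoted h r k' :=
  let ⟨p, hp, i, hi⟩ := H
  ⟨p, hp, i, sent_mono hk hi⟩

lemma Precommitted.mono {r k k' : ℕ} (hk : k ≤ k') (H : e.Precommitted h r k) :
    e.Precommitted h r k' :=
  let ⟨p, hp, i, hi⟩ := H
  ⟨p, hp, i, sent_mono hk hi⟩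

lemma not_prevoted_zero (e : Execution sys faulty GST Δ) (h r : ℕ) : ¬ e.Prevoted h r 0 := by
  rintro ⟨p, -, i, hi⟩
  simp [e.state_zero, LState.initial] at hi

lemma not_precommitted_zero (e : Execution sys faulty GST Δ) (h r : ℕ) :
    ¬ e.Precommitted h r 0 := by
  rintro ⟨p, -, i, hi⟩
  simp [e.state_zero, LState.initial] at hi

lemma Prevoted.of_quorum (hf : ∑ p ∈ faulty, sys.power p ≤ par.f) {r k : ℕ} {p : P}
    (hquorum : 2 * par.f + 1 ≤ sys.weight (prevoters (e.state k p).log h r)) :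
    e.Prevoted h r k := by
  obtain ⟨q, ⟨i, hi⟩, hq, -⟩ := sys.exists_mem_of_weight hf
    (A := prevoters (e.state k p).log h r) (by omega)
  exact ⟨q, hq, i, sent_of_log hi hq⟩

namespace Window

variable (W : e.Window h T T') {t : ℝ}
include W

/-- The messages that make one correct process lock make all the others update their valid
round. -/
lemma polka_spread {r k : ℕ} {p : P} (hp : p ∉ faulty) (hpolka : Polka sys h r (e.state k p).log)
    (hk : k ≤ e.idx t) (ht : T ≤ t) (ht' : t + Δ ≤ T')
    (hn : ¬ e.Entered h (r + 1) (e.idx (t + Δ))) {q : P} (hq : q ∉ faulty)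
    (hpast : (e.snap (t + Δ) q).Past h r 1) :
    (e.snap (t + Δ) q).round = r ∧ (e.snap (t + Δ) q).step = Phase.precommit ∧
      (e.snap (t + Δ) q).validRound = r := by
  have hΔ := W.delta_pos
  obtain ⟨v, vr, hmsg, hquorum, hvalid⟩ := hpolka
  obtain ⟨hr, hstep⟩ := W.round_eq hq (by linarith) ht' hpast hn
  have hh := W.height_eq hq (by linarith) ht'
  have hdone := polka_snap hq (W.active hq (by linarith) ht') (v := v) (vr := vr)
    (by rw [hh, hr]; exact W.gossip hp hmsg rfl hk ht ht' hq)
    (by rw [hh, hr]; exact W.prevotersFor_gossip hp hquorum hk ht ht' hq) hvalid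
    (by intro h; simp [h, Phase.num] at hstep)
  have := (W.run hq (by linarith) ht').polka_done hdone
  rw [hr] at this
  exact ⟨hr, this⟩

/-- All correct processes prevote soon after the first one. -/
lemma prevote_spread {r : ℕ} {τ u : ℝ} (S : e.Sync h r T τ) (hu : e.FirstTime (e.Prevoted h r) u)
    (hT : u + Δ ≤ T') (hn : ¬ e.Entered h (r + 1) (e.idx (u + Δ))) {q : P} (hq : q ∉ faulty) :
    (e.snap (u + Δ) q).Past h r 1 := by
  have hΔ := W.delta_pos
  obtain ⟨k, hk, hnk, y, hy, i, hi⟩ := hu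
  have hτu : τ ≤ u := hk ▸ S.le_time hy ((e.inv y (k + 1)).sent_past _ hi)
  have hTτ := S.le
  have hku : k < e.idx u := lt_idx.2 hk.le
  obtain ⟨h1, h2, h3, h4, hreason⟩ :=
    (e.effect y k).prevote_reason hi fun h => hnk ⟨y, hy, i, h⟩
  have hpast : (e.snap (u + Δ) q).Past h r 0 := past_mono (idx_mono (by linarith)) (S.all q hq)
  obtain ⟨hr, -⟩ := W.round_eq hq (by linarith) hT hpast hn
  have hh := W.height_eq hq (by linarith) hT
  have ha := W.active hq (by linarith) hT
  have hpos : (e.snap (u + Δ) q).step ≠ Phase.propose → (e.snap (u + Δ) q).Past h r 1 := by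
    intro hstep
    refine ⟨ha.1, Or.inr ⟨hh, Or.inr ⟨hr, ?_⟩⟩⟩
    cases hs : (e.snap (u + Δ) q).step <;> simp_all [Phase.num]
  rw [PrevoteReason, h1, h2] at hreason
  rcases hreason with ⟨v, hmsg, -⟩ | ⟨v, vr, hmsg, hvr, hquorum, -⟩ | ⟨d, hd, htm⟩
  · exact hpos (step_ne_propose_of_new hq ha (v := v) (by
      rw [hh, hr]; exact W.gossip hy hmsg rfl hku.le (by linarith) hT hq))
  · exact hpos (step_ne_propose_of_old hq ha (v := v) (vr := vr)
      (by rw [hh, hr]; exact W.gossip hy hmsg rfl hku.le (by linarith) hT hq)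
      (by rw [hh]; exact W.prevotersFor_gossip hy hquorum hku.le (by linarith) hT hq)
      (by rwa [hr]))
  -- The expired timer was set no earlier than `τ`, so `u` is at least `τ` plus the timeout. All
  -- others entered by `τ + Δ`, so their own propose phases end by `u + Δ`.
  · obtain ⟨j, hj, h5, h6, -⟩ := timer_reason htm
    have h7 := S.le_time hy h6
    have h8 := par.timeoutPropose_nonneg r
    simp only [Params.timeout] at h5
    exact past_mono (idx_mono (by linarith)) (W.past_prevote hq (t := τ + Δ) (by linarith)
      (by linarith) (S.all q hq))

/-- If a correct process locks in a synchronous round, then all correct processes update their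
valid round before the next round starts. -/
lemma valid_of_lock {r : ℕ} {τ τ' : ℝ} (S : e.Sync h r T τ)
    (hτ' : e.FirstTime (e.Entered h (r + 1)) τ') (hT : τ' ≤ T') {p : P} (hp : p ∉ faulty) {k : ℕ}
    (hh : (e.state k p).height = h) (hr : (e.state k p).round = r)
    (hstep : (e.state k p).step = Phase.prevote)
    (hpolka : Polka sys h r (e.state k p).log) {q : P} (hq : q ∉ faulty) :
    ∃ t, T ≤ t ∧ t ≤ T' ∧ (e.snap t q).round = r ∧ (e.snap t q).validRound = r := by
  have hΔ := W.delta_pos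
  have hTτ := S.le
  have hlong := S.precommit_long
  have hnot : ∀ {t}, t < τ' → ¬ e.Entered h (r + 1) (e.idx t) := fun ht hE =>
    (hτ'.le_of_idx Entered.mono hE).not_gt ht
  -- Let `s` be the time of the first correct precommit of the round. The next round starts at least
  -- a precommit timeout later, which leaves ample time for gossip after `s`.
  obtain ⟨s, hs, hfs⟩ : ∃ s, s + par.timeoutPrecommit r ≤ τ' ∧
      e.FirstTime (e.Precommitted h r) s := by
    obtain ⟨j, hj, hP⟩ := W.precommit_of_entered hT (hτ'.idx Entered.mono le_rfl)
    obtain ⟨s, hs, hfs⟩ := FirstTime.of_idx (e.not_precommitted_zero h r) (t := e.time j)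
      (Precommitted.mono (lt_idx.2 le_rfl).le hP)
    exact ⟨s, by linarith, hfs⟩
  obtain ⟨k₁, hk₁, hnk₁, x, hx, i, hi⟩ := hfs
  obtain ⟨h1, h2, h3, h4, hreason⟩ :=
    (e.effect x k₁).precommit_reason hi fun h => hnk₁ ⟨x, hx, i, h⟩
  have hks : k₁ < e.idx s := lt_idx.2 hk₁.le
  have hPV : e.Prevoted h r k₁ := by
    have ha : Active sys (e.state k₁ x) := ⟨h4, by rw [h1]; exact W.height_lt⟩
    have := ((e.inv x k₁).run ha).has_prevote (by simp [h3])
    rw [h1, h2] at this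
    exact ⟨x, hx, this⟩
  obtain ⟨u, hus, hu⟩ := FirstTime.of_idx (e.not_prevoted_zero h r) (Prevoted.mono hks.le hPV)
  have hτu : τ ≤ u := by
    obtain ⟨k, hk, hnk, y, hy, i, hi⟩ := hu
    exact hk ▸ S.le_time hy ((e.inv y (k + 1)).sent_past _ hi)
  have hall : ∀ q ∉ faulty, (e.snap (u + Δ) q).Past h r 1 := fun q hq =>
    W.prevote_spread S hu (by linarith) (hnot (by linarith)) hq
  rw [PrecommitReason, h1, h2] at hreason
  rcases hreason with ⟨v, vr, hmsg, hquorum, hvalid, -⟩ | hquorum | ⟨d, hd, htm⟩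
  -- The first precommit was itself caused by a proposal with its quorum, which spreads by `s + Δ`.
  · obtain ⟨h5, -, h6⟩ := W.polka_spread hx ⟨v, vr, hmsg, hquorum, hvalid⟩ hks.le (by linarith)
      (by linarith) (hnot (by linarith)) hq (past_mono (idx_mono (by linarith)) (hall q hq))
    exact ⟨s + Δ, by linarith, by linarith, h5, h6⟩
  -- Quorums for nil and for a value would share a correct process with two different prevotes.
  · obtain ⟨v, vr, -, hquorum', -⟩ := hpolka
    obtain ⟨y, hy1, hy2, hy, -⟩ := sys.exists_mem_inter_of_weight W.faulty_le hquorum hquorum'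
    have h5 := sent_mono (le_max_left k₁ k) (sent_of_log hy1 hy)
    have h6 := sent_mono (le_max_right k₁ k) (sent_of_log hy2 hy)
    simpa using (e.inv y (max k₁ k)).prevote_unique _ _ _ _ h5 h6
  -- The first precommit was caused by a prevote timeout, so `s` is at least `u` plus that timeout.
  -- Everybody has a quorum of prevotes by `u + 2 * Δ`, so the locking process leaves step `prevote`
  -- by `s + 2 * Δ`, and its messages spread by `s + 3 * Δ`.
  · obtain ⟨j, hj, h5, -, h6, -⟩ := timer_reason htm
    have h7 : u ≤ e.time j :=
      hu.le_time Prevoted.mono (Prevoted.of_quorum W.faulty_le (h6 rfl))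
    have h8 := par.timeoutPrevote_nonneg r
    simp only [Params.timeout] at h5
    have hprevoters : ∀ q ∉ faulty,
        2 * par.f + 1 ≤ sys.weight (prevoters (e.snap (u + Δ + Δ) q).log h r) := by
      intro q hq
      refine W.prevoters_of_all (by linarith) (by linarith) (fun y hy => ?_) hq
      obtain ⟨h9, h10⟩ := W.round_eq hy (by linarith) (by linarith) (hall y hy)
        (hnot (by linarith))
      exact W.prevoted hy (by linarith) (by linarith) h9 h10
    have hpast : (e.snap (u + Δ + Δ + par.timeoutPrevote r) p).Past h r 2 :=
      W.past_precommit hp (by linarith) (by linarith)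
        (past_mono (idx_mono (by linarith)) (hall p hp)) (hprevoters p hp)
    have hk : k ≤ e.idx (u + Δ + Δ + par.timeoutPrevote r) := by
      by_contra hlt
      have := (past_mono (not_le.1 hlt).le hpast).2
      simp [hh, hr, hstep, Phase.num] at this
    obtain ⟨h5, -, h6⟩ := W.polka_spread hp hpolka hk (by linarith) (by linarith)
      (hnot (by linarith)) hq (past_mono (idx_mono (by linarith)) (hall q hq))
    exact ⟨_, by linarith, by linarith, h5, h6⟩

/-- The valid round equals `r` at some instant when `q` is still in round `r`, hence before any
state of `q` in a later round, and valid rounds never decrease within a height. -/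
lemma valid_ge_of_locked {r k k' : ℕ} {τ τ' : ℝ} (S : e.Sync h r T τ)
    (hτ' : e.FirstTime (e.Entered h (r + 1)) τ') (hT : τ' ≤ T') {p q : P} (hp : p ∉ faulty)
    (hh : (e.state k p).height = h) (hlock : (e.state k p).lockedRound = r) (hq : q ∉ faulty)
    (hs' : (e.state k' q).started = true) (hh' : (e.state k' q).height = h) (hr' : r < (e.state k' q).round) :
    (r : ℤ) ≤ (e.state k' q).validRound := by
  obtain ⟨j, hj, h1, h2, -, h3, -, -, -, hpolka⟩ := lock_reason hh hlock
  obtain ⟨t, ht, ht', h4, h5⟩ := W.valid_of_lock S hτ' hT hp h1 h2 h3 hpolka hq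
  have h6 := W.height_eq hq ht ht'
  have hk : e.idx t ≤ k' := by
    by_contra hlt
    have hpast : (e.state k' q).Past h (r + 1) 0 := ⟨hs', by omega⟩
    have := (past_mono (not_le.1 hlt).le hpast).2
    simp only [snap] at h4 h6
    omega
  rw [← h5]
  exact valid_mono hk (by rw [hh']; exact h6.symm)

end Window

end Execution

/-! ### A synchronous round with a good proposer ends in a decision. -/

namespace Execution

variable {sys : System par P V I} {faulty : Finset P} {GST Δ : ℝ}
  {e : Execution sys faulty GST Δ} {h : ℕ} {T T' : ℝ}

namespace Window

variable (W : e.Window h T T')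
include W

/-- A synchronous round whose correct proposer has a valid round that is at least the locked round
of all others ends with a decision. -/
lemma not_sync_of_proposer {r : ℕ} {τ : ℝ} (S : e.Sync h r T τ) (hT : τ + 4 * Δ ≤ T')
    {q : P} (hq : q ∉ faulty) (hprop : sys.proposer h r = q)
    (hlock : ∀ x ∉ faulty, 0 < sys.power x → ∀ k k', (e.state k x).started = true →
      (e.state k x).height = h → (e.state k x).round = r → (e.state k x).step = Phase.propose →
      (e.state k' q).started = true → (e.state k' q).height = h → (e.state k' q).round = r →
      (e.state k x).lockedRound ≤ (e.state k' q).validRound) : False := by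
  have hΔ := W.delta_pos
  have hTτ := S.le
  have hl1 := S.propose_long
  have hl2 := S.prevote_long
  have hl3 := S.precommit_long
  have hround : ∀ t, τ + Δ ≤ t → t ≤ τ + 4 * Δ → ∀ x ∉ faulty, (e.snap t x).round = r :=
    fun t ht ht' x hx => (W.round_eq hx (by linarith) (by linarith)
      (past_mono (idx_mono ht) (S.all x hx)) (S.not_entered W (by linarith) (by linarith))).1
  have hheight : ∀ t, τ + Δ ≤ t → t ≤ τ + 4 * Δ → ∀ x ∉ faulty, (e.snap t x).height = h :=
    fun t ht ht' x hx => W.height_eq hx (by linarith) (by linarith)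
  have hact : ∀ t, τ + Δ ≤ t → t ≤ τ + 4 * Δ → ∀ x ∉ faulty, Active sys (e.snap t x) :=
    fun t ht ht' x hx => W.active hx (by linarith) (by linarith)
  -- the proposal
  obtain ⟨v, vr, vv, hsent, hv, hvv, hspec⟩ :=
    (W.run hq (t := τ + Δ) (by linarith) (by linarith)).has_proposal (by
      rw [hheight _ le_rfl (by linarith) q hq, hround _ le_rfl (by linarith) q hq, hprop])
  rw [hheight _ le_rfl (by linarith) q hq, hround _ le_rfl (by linarith) q hq] at hsent hspec
  have hproposal : ∀ t, τ + Δ + Δ ≤ t → t ≤ τ + 4 * Δ → ∀ x ∉ faulty,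
      Msg.proposal (sys.proposer h r) h r v vr ∈ (e.snap t x).log := by
    intro t ht ht' x hx
    rw [hprop]
    exact log_mono (idx_mono ht) (W.gossip_sent hq hsent rfl le_rfl (by linarith) (by linarith) hx)
      (hheight t (by linarith) ht' x hx).le
  -- The proposer is correct and proposes only once per round, so no competing proposal can appear
  -- in any log.
  have hunique : ∀ {k : ℕ} {x : P} {v' : V} {vr' : ℤ},
      Msg.proposal (sys.proposer h r) h r v' vr' ∈ (e.state k x).log → v' = v ∧ vr' = vr := by
    intro k x v' vr' hm
    rw [hprop] at hm
    have h1 := sent_mono (le_max_left k (e.idx (τ + Δ))) (sent_of_log hm hq)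
    have h2 := sent_mono (le_max_right k (e.idx (τ + Δ))) hsent
    exact (e.inv q _).proposal_unique _ _ _ _ _ _ h1 h2
  obtain ⟨k', -, hk1, hk2, hk3, hk4⟩ := proposal_reason hsent
  have hlocked : ∀ x ∉ faulty, 0 < sys.power x → ∀ k, (e.state k x).started = true →
      (e.state k x).height = h → (e.state k x).round = r → (e.state k x).step = Phase.propose →
      (e.state k x).lockedRound ≤ vr := fun x hx hpos k h1 h2 h3 h4 =>
    hk4 ▸ hlock x hx hpos k k' h1 h2 h3 h4 hk3 hk1 hk2
  have htimer : ∀ {k : ℕ} {x : P} {kind : Phase} {d : ℝ}, x ∉ faulty →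
      (⟨kind, h, r, d⟩ : Timer) ∈ (e.state k x).timers → τ + par.timeout kind r ≤ d := by
    intro k x kind d hx htm
    obtain ⟨j, hj, h1, h2, -⟩ := timer_reason htm
    have := S.le_time hx h2
    simp only at h1
    linarith
  -- the prevotes
  have hstep1 : ∀ x ∉ faulty, (e.snap (τ + Δ + Δ) x).step ≠ Phase.propose := by
    intro x hx
    have h1 := hheight (τ + Δ + Δ) (by linarith) (by linarith) x hx
    have h2 := hround (τ + Δ + Δ) (by linarith) (by linarith) x hx
    have h3 := hproposal (τ + Δ + Δ) le_rfl (by linarith) x hx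
    have h4 := hact (τ + Δ + Δ) (by linarith) (by linarith) x hx
    rcases hspec with ⟨rfl, -⟩ | ⟨n, v', rfl, hn, rfl, -, hquorum⟩
    · exact step_ne_propose_of_new hx h4 (v := v) (by rwa [h1, h2])
    · obtain rfl : v' = v := by simpa using hvv
      exact step_ne_propose_of_old hx h4 (v := v') (vr := n) (by rwa [h1, h2])
        (by rw [h1]; exact W.prevotersFor_gossip hq hquorum le_rfl (by linarith) (by linarith) hx)
        (by rwa [h2])
  -- A state of the round with a step below position `n` precedes every snapshot that has reached
  -- position `n`.
  have hbefore : ∀ {t : ℝ} {j n : ℕ} {x : P}, x ∉ faulty → τ + Δ ≤ t → t ≤ τ + 4 * Δ →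
      (e.state j x).height = h → (e.state j x).round = r → (e.state j x).step.num < n →
      n ≤ (e.snap t x).step.num → e.time j ≤ t := by
    intro t j n x hx ht ht' h1 h2 h3 h4
    refine lt_idx.1 (not_le.1 fun hle => ?_)
    have h5 : (e.snap t x).Past h r n := ⟨(hact t ht ht' x hx).1,
      Or.inr ⟨hheight t ht ht' x hx, Or.inr ⟨hround t ht ht' x hx, h4⟩⟩⟩
    have := (past_mono hle h5).2
    omega
  have hnum1 : ∀ x ∉ faulty, 1 ≤ (e.snap (τ + Δ + Δ) x).step.num := by
    intro x hx
    have := hstep1 x hx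
    cases hs : (e.snap (τ + Δ + Δ) x).step <;> simp_all [Phase.num]
  -- Locks are controlled only for positive power; other votes add nothing to a quorum.
  have hprevote : ∀ x ∉ faulty, 0 < sys.power x → ∀ k i,
      Msg.prevote x h r i ∈ (e.state k x).sent → i = some (sys.idOf v) := by
    intro x hx hpos k i hi
    obtain ⟨j, hj, h1, h2, h3, h4, hreason⟩ := prevote_reason hi
    have h5 := hlocked x hx hpos j h4 h1 h2 h3
    have h6 := hbefore hx (t := τ + Δ + Δ) (by linarith) (by linarith) h1 h2
      (by simp [h3, Phase.num]) (hnum1 x hx)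
    rw [PrevoteReason, h1, h2] at hreason
    rcases hreason with ⟨v', hmsg, hc⟩ | ⟨v', vr', hmsg, -, -, hc⟩ | ⟨d, hd, htm⟩
    · obtain ⟨rfl, h7⟩ := hunique hmsg
      -- For a fresh proposal `vr = -1`, and `-1 ≤ lockedRound ≤ vr` means that the process is
      -- unlocked.
      have := (e.inv x j).locked_ge
      exact hc ⟨hv, Or.inl (by omega)⟩
    · obtain ⟨rfl, h7⟩ := hunique hmsg
      exact hc ⟨hv, Or.inl (by omega)⟩
    -- The prevote is cast by `τ + 2 * Δ`, long before a propose timeout of this round can be due.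
    · have := htimer hx htm
      simp only [Params.timeout] at this
      linarith
  have hquorum : ∀ x ∉ faulty, 2 * par.f + 1 ≤
      sys.weight (prevotersFor (e.snap (τ + Δ + Δ + Δ) x).log h r (some (sys.idOf v))) := by
    intro x hx
    refine sys.quorum_le_weight W.faulty_le fun y hy hpos => ?_
    obtain ⟨i, hi⟩ := W.prevoted hy (t := τ + Δ + Δ) (by linarith) (by linarith)
      (hround _ (by linarith) (by linarith) y hy) (hnum1 y hy)
    obtain rfl := hprevote y hy hpos _ _ hi
    exact W.gossip_sent hy hi rfl le_rfl (by linarith) (by linarith) hx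
  -- the precommits
  have hstep2 : ∀ x ∉ faulty, (e.snap (τ + Δ + Δ + Δ) x).step = Phase.precommit := by
    intro x hx
    have h1 := hheight (τ + Δ + Δ + Δ) (by linarith) (by linarith) x hx
    have h2 := hround (τ + Δ + Δ + Δ) (by linarith) (by linarith) x hx
    refine ((W.run hx (by linarith) (by linarith)).polka_done (polka_snap hx
      (hact _ (by linarith) (by linarith) x hx) (v := v) (vr := vr) ?_ ?_ hv ?_)).1
    · rw [h1, h2]
      exact hproposal _ (by linarith) (by linarith) x hx
    · rw [h1, h2]
      exact hquorum x hx
    · intro hs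
      have h3 : (e.snap (τ + Δ + Δ) x).Past h r 1 :=
        ⟨(hact _ (by linarith) (by linarith) x hx).1,
          Or.inr ⟨hheight _ (by linarith) (by linarith) x hx,
            Or.inr ⟨hround _ (by linarith) (by linarith) x hx, hnum1 x hx⟩⟩⟩
      have h4 : (e.snap (τ + Δ + Δ + Δ) x).Past h r 1 := past_mono (idx_mono (by linarith)) h3
      have h5 := h4.2
      rw [h1, h2, hs] at h5
      simp [Phase.num] at h5
  have hprecommit : ∀ x ∉ faulty, ∀ k i,
      Msg.precommit x h r i ∈ (e.state k x).sent → i = some (sys.idOf v) := by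
    intro x hx k i hi
    obtain ⟨j, hj, h1, h2, h3, h4, hreason⟩ := precommit_reason hi
    have h6 := hbefore hx (t := τ + Δ + Δ + Δ) (n := 2) (by linarith) (by linarith) h1 h2
      (by simp [h3, Phase.num]) (by simp [hstep2 x hx, Phase.num])
    rw [PrecommitReason, h1, h2] at hreason
    rcases hreason with ⟨v', vr', hmsg, -, -, rfl⟩ | hnil | ⟨d, hd, htm⟩
    · rw [(hunique hmsg).1]
    -- A quorum for nil would contain a correct process of positive power, and these all prevote for
    -- `v`.
    · obtain ⟨y, hy, hyf, hpos⟩ := sys.exists_mem_of_weight W.faulty_le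
        (A := prevotersFor (e.state j x).log h r none) (by omega)
      simpa using hprevote y hyf hpos _ _ (sent_of_log hy hyf)
    · have := htimer hx htm
      simp only [Params.timeout] at this
      linarith
  refine not_decision_snap hq (hact (τ + Δ + Δ + Δ + Δ) (by linarith) (by linarith) q hq) ?_
  rw [DecisionReason, hheight _ (by linarith) (by linarith) q hq]
  refine ⟨r, v, vr, hproposal _ (by linarith) (by linarith) q hq, ?_, hv⟩
  refine sys.quorum_le_weight W.faulty_le fun y hy hpos => ?_
  obtain ⟨i, hi⟩ := W.precommitted hy (t := τ + Δ + Δ + Δ) (by linarith) (by linarith)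
    (hround _ (by linarith) (by linarith) y hy) (by simp [hstep2 y hy, Phase.num])
  obtain rfl := hprecommit y hy _ _ hi
  exact W.gossip_sent hy hi rfl le_rfl (by linarith) (by linarith) hq

end Window

end Execution

/-! ### Choice of a deciding round. -/

lemma System.exists_proposer (sys : System par P V I) (h a : ℕ) {q : P} (hq : 0 < sys.power q) :
    ∃ r, a ≤ r ∧ r < a + par.n ∧ sys.proposer h r = q := by
  rw [← sys.weighted_round_robin h a q] at hq
  obtain ⟨i, hi, hiq⟩ := Set.nonempty_of_ncard_ne_zero hq.ne'
  exact ⟨a + i, by omega, by omega, hiq⟩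

lemma Inv.locked_le_round {sys : System par P V I} {p : P} {s : LState P V I}
    (H : Inv sys p s) : s.lockedRound ≤ s.round := by
  refine H.locked_le.trans ?_
  rcases H.valid_spec with ⟨h, -⟩ | ⟨n, v, h, hn, -⟩ <;> omega

namespace Execution

variable {sys : System par P V I} {faulty : Finset P} {GST Δ : ℝ}
  {e : Execution sys faulty GST Δ} {h : ℕ} {T T' : ℝ}

/-- Locking in the current round moves the process to step `precommit`, and it does not return to
`propose` in the same round. -/
lemma locked_lt_round {k : ℕ} {p : P} (hstep : (e.state k p).step = Phase.propose) :
    (e.state k p).lockedRound < (e.state k p).round := by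
  refine lt_of_le_of_ne (e.inv p k).locked_le_round fun heq => ?_
  obtain ⟨j, hj, -, -, h1, -, h2, h3, h4, -⟩ := lock_reason rfl heq
  have hpast : (e.state (j + 1) p).Past (e.state k p).height (e.state k p).round 2 :=
    ⟨started_mono (Nat.le_succ j) h1, Or.inr ⟨h2, Or.inr ⟨h3, by simp [h4, Phase.num]⟩⟩⟩
  have := (past_mono hj hpast).2
  simp [hstep, Phase.num] at this

/-- Within a window, correct processes decide after a bounded number of rounds. -/
lemma Window.false_of_long (W : e.Window h T T') {r₀ M R : ℕ}
    (hr₀ : ¬ e.Entered h (r₀ + 1) (e.idx T)) (hM : 10 * Δ ≤ M * par.timeoutDelta)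
    (hR : R = r₀ + 2 + M) (hT : T + par.reachBound Δ (R + 2 * par.n + 2) + 4 * Δ ≤ T') :
    False := by
  classical
  have hΔ := W.delta_pos
  have hbound : ∀ {r}, r ≤ R + 2 * par.n + 2 →
      T + par.reachBound Δ r ≤ T + par.reachBound Δ (R + 2 * par.n + 2) := fun hr => by
    linarith [par.reachBound_mono hΔ hr]
  have hsync : ∀ r, R ≤ r → r ≤ R + 2 * par.n + 2 →
      ∃ τ, τ + 4 * Δ ≤ T' ∧ e.Sync h r T τ := by
    intro r hr hr'
    have h1 := hbound hr'
    have h2 : (M : ℝ) * par.timeoutDelta ≤ r * par.timeoutDelta :=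
      mul_le_mul_of_nonneg_right (by exact_mod_cast (by omega : M ≤ r)) par.timeoutDelta_pos.le
    obtain ⟨τ, hτ, S⟩ := W.exists_sync hr₀ (r := r) (by omega) (by linarith) (by linarith)
    exact ⟨τ, by linarith, S⟩
  have hvalid : ∀ r, R ≤ r → r ≤ R + 2 * par.n + 1 → ∀ p ∉ faulty, ∀ k,
      (e.state k p).height = h → (e.state k p).lockedRound = r → ∀ q ∉ faulty, ∀ k',
      (e.state k' q).started = true → (e.state k' q).height = h →
      r < (e.state k' q).round → (r : ℤ) ≤ (e.state k' q).validRound := by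
    intro r hr hr' p hp k h1 h2 q hq k' h3 h4 h5
    obtain ⟨τ, -, S⟩ := hsync r hr (by omega)
    obtain ⟨τ', hτ', S'⟩ := hsync (r + 1) (by omega) (by omega)
    exact W.valid_ge_of_locked S S'.first (by linarith) hp h1 h2 hq h3 h4 h5
  by_cases hA : ∃ p ∉ faulty, ∃ k, ∃ r₁ : ℕ, R ≤ r₁ ∧ r₁ ≤ R + par.n ∧
      (e.state k p).height = h ∧ (e.state k p).lockedRound = r₁
  · obtain ⟨p, hp, k₁, r₁, hr₁, hr₁', hh, hlock⟩ := hA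
    obtain ⟨q, hq, hpos⟩ := W.exists_correct
    -- Some process locked in a round up to `R + n`; any correct proposer in the next `n` rounds
    -- will do.
    obtain ⟨r, h1, h2, hprop⟩ := sys.exists_proposer h (R + par.n + 1) hpos
    obtain ⟨τ, hτ, S⟩ := hsync r (by omega) (by omega)
    refine W.not_sync_of_proposer S hτ hq hprop ?_
    intro x hx _ k k' _ h4 h5 h6 h7 h8 h9
    have h10 := hvalid r₁ hr₁ (by omega) p hp k₁ hh hlock q hq k' h7 h8 (by omega)
    have h11 := locked_lt_round h6
    by_cases hle : (e.state k x).lockedRound ≤ r₁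
    · omega
    -- A lock newer than `r₁` was also made in a synchronous round before `r`, so it too is
    -- dominated by the valid round of `q`.
    · obtain ⟨r₂, hr₂⟩ := Int.eq_ofNat_of_zero_le (a := (e.state k x).lockedRound) (by omega)
      have := hvalid r₂ (by omega) (by omega) x hx k h4 hr₂ q hq k' h7 h8 (by omega)
      omega
  -- No lock is made in rounds `R` to `R + n`, so all locks there date from before `R`.
  · have hB : ∀ p ∉ faulty, ∀ k, (e.state k p).height = h → (e.state k p).round ≤ R + par.n →
        (e.state k p).lockedRound < R := by
      intro p hp k hh hr
      by_contra hlt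
      have h1 := (e.inv p k).locked_le_round
      obtain ⟨r₂, hr₂⟩ := Int.eq_ofNat_of_zero_le (a := (e.state k p).lockedRound) (by omega)
      exact hA ⟨p, hp, k, r₂, by omega, by omega, hh, hr₂⟩
    have hconst : ∀ p ∉ faulty, ∀ k k', (e.state k p).started = true →
        (e.state k p).height = h → (e.state k p).round ≤ R + par.n → R ≤ (e.state k p).round →
        (e.state k' p).started = true → (e.state k' p).height = h →
        (e.state k' p).round ≤ R + par.n → R ≤ (e.state k' p).round →
        (e.state k p).lockedRound = (e.state k' p).lockedRound := by
      intro p hp k k' h1 h2 h3 h4 h1' h2' h3' h4'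
      have h5 := hB p hp k h2 h3
      have h6 := hB p hp k' h2' h3'
      rcases le_total k k' with hk | hk
      · rcases locked_eq_or_le hk (by rw [h2, h2']) h1 with h | h
        · exact h.symm
        · omega
      · rcases locked_eq_or_le hk (by rw [h2, h2']) h1' with h | h
        · exact h
        · omega
    obtain ⟨σ, hσ, SR⟩ := hsync R le_rfl (by omega)
    have hTσ := SR.le
    have hlong := SR.precommit_long
    -- The maximum is taken over positive power only, since a process of power `0` never becomes
    -- proposer.
    obtain ⟨p, hpmem, hmax⟩ := Finset.exists_max_image
      (Finset.univ.filter fun p => p ∉ faulty ∧ 0 < sys.power p)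
      (fun p => (e.snap (σ + Δ) p).lockedRound) (by
        obtain ⟨p, hp, hpos⟩ := W.exists_correct
        exact ⟨p, by simp [hp, hpos]⟩)
    simp only [Finset.mem_filter, Finset.mem_univ, true_and] at hpmem hmax
    obtain ⟨hp, hpos⟩ := hpmem
    obtain ⟨r, h1, h2, hprop⟩ := sys.exists_proposer h R hpos
    obtain ⟨τ, hτ, S⟩ := hsync r h1 (by omega)
    have hsnap : ∀ x ∉ faulty, ∀ k, (e.state k x).started = true → (e.state k x).height = h →
        (e.state k x).round = r → (e.state k x).lockedRound = (e.snap (σ + Δ) x).lockedRound := by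
      intro x hx k h3 h4 h5
      have hround := (W.round_eq hx (t := σ + Δ) (by linarith) (by linarith) (SR.all x hx)
        (SR.not_entered W (by linarith) (by linarith))).1
      have hheight := W.height_eq hx (t := σ + Δ) (by linarith) (by linarith)
      exact hconst x hx k _ h3 h4 (by omega) (by omega)
        (W.active hx (by linarith) (by linarith)).1 hheight (hround.le.trans (by omega)) hround.ge
    refine W.not_sync_of_proposer S hτ hp hprop ?_
    intro x hx hxpos k k' h3 h4 h5 _ h7 h8 h9
    have h10 := hmax x ⟨hx, hxpos⟩
    rw [hsnap x hx k h3 h4 h5]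
    exact h10.trans ((hsnap p hp k' h7 h8 h9).symm.le.trans (e.inv p k').locked_le)

end Execution

/-! ### The time bound and induction on the height. -/

/-- The time within which all correct processes decide. -/
noncomputable def Params.decisionBound (par : Params) (Δ : ℝ) (r₀ : ℕ) : ℝ :=
  -- The term `r₀ + 2` makes rounds start together, the ceiling makes their timeouts long, `2 * n`
  -- covers two rotations of the proposers, and `4 * Δ` lets the last round finish.
  par.reachBound Δ (r₀ + 2 + ⌈10 * Δ / par.timeoutDelta⌉₊ + 2 * par.n + 2) + 4 * Δ

lemma Params.decisionBound_pos (par : Params) {Δ : ℝ} (hΔ : 0 < Δ) (r₀ : ℕ) :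
    0 < par.decisionBound Δ r₀ := by
  have : 0 ≤ par.reachBound Δ (r₀ + 2 + ⌈10 * Δ / par.timeoutDelta⌉₊ + 2 * par.n + 2) :=
    par.reachBound_mono hΔ (Nat.zero_le _)
  unfold decisionBound
  linarith

namespace Execution

variable {sys : System par P V I} {faulty : Finset P} {GST Δ : ℝ}
  {e : Execution sys faulty GST Δ} {h : ℕ} {T : ℝ}

/-- All correct processes leave height `h` within bounded time. -/
lemma height_lt_of_bound (hf : ∑ p ∈ faulty, sys.power p ≤ par.f) (hΔ : 0 < Δ)
    (hh : (h : ℕ∞) < sys.heights) (hT : GST ≤ T)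
    (hreached : ∀ p ∉ faulty, (e.snap T p).Past h 0 0) {r₀ : ℕ}
    (hr₀ : ∀ p ∉ faulty, (e.snap T p).height = h → (e.snap T p).round ≤ r₀) {q : P}
    (hq : q ∉ faulty) : h < (e.snap (T + par.decisionBound Δ r₀ + Δ) q).height := by
  have hB := par.decisionBound_pos hΔ r₀
  by_cases hdec : ∃ p ∉ faulty, h < (e.snap (T + par.decisionBound Δ r₀) p).height
  -- If one correct process has left the height, the messages behind its decision reach `q` within
  -- another `Δ`, and urgency forbids `q` to remain undecided with them.
  · obtain ⟨p, hp, hlt⟩ := hdec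
    obtain ⟨j, hj, h1, h2⟩ := exists_first_step (Q := fun k => h < (e.state k p).height)
      (by simp [e.state_zero, LState.initial]) hlt
    obtain ⟨h3, ⟨r, v, vr, hmsg, hquorum, hvalid⟩, -⟩ :=
      (e.effect p j).decide_reason (by omega)
    have h4 : (e.state j p).height = h := by omega
    rw [h4] at hmsg hquorum
    by_contra hle
    have hpast : (e.snap (T + par.decisionBound Δ r₀ + Δ) q).Past h 0 0 :=
      past_mono (idx_mono (by linarith)) (hreached q hq)
    have h5 : (e.snap (T + par.decisionBound Δ r₀ + Δ) q).height = h := by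
      have := hpast.2
      omega
    have hgossip : ∀ m ∈ (e.state j p).log, m.height = h →
        m ∈ (e.snap (T + par.decisionBound Δ r₀ + Δ) q).log := fun m hm hmh =>
      gossip_snap hp hm hj.le (by linarith) hq (by omega)
    refine not_decision_snap hq ⟨hpast.1, by rwa [h5]⟩ ?_
    rw [DecisionReason, h5]
    exact ⟨r, v, vr, hgossip _ hmsg rfl,
      hquorum.trans (sys.weight_mono (precommittersFor_mono hgossip)), hvalid⟩
  · exfalso
    push Not at hdec
    have W : e.Window h T (T + par.decisionBound Δ r₀) :=
      ⟨hf, hΔ, hT, hh, hreached, hdec⟩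
    refine W.false_of_long (r₀ := r₀) ?_ (M := ⌈10 * Δ / par.timeoutDelta⌉₊) ?_ rfl ?_
    · rintro ⟨p, hp, hpast⟩
      have h1 := W.height_eq hp le_rfl (by linarith)
      have h2 := hr₀ p hp h1
      have h3 : (e.snap T p).Past h (r₀ + 1) 0 := hpast
      have := h3.2
      omega
    · have := Nat.le_ceil (10 * Δ / par.timeoutDelta)
      rwa [div_le_iff₀ par.timeoutDelta_pos] at this
    · unfold Params.decisionBound
      linarith

lemma decidedBy_of_height_lt {p : P} {t : ℝ} (hlt : h < (e.snap t p).height) :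
    e.DecidedBy p h t := by
  cases hk : e.idx t with
  | zero => simp [snap, hk, e.state_zero, LState.initial] at hlt
  | succ k =>
    have h1 : (e.snap t p).decision h ≠ none := fun hnone =>
      hlt.not_ge (((e.inv p _).decided _).1 hnone)
    rw [snap, hk] at h1
    exact ⟨k, lt_idx.1 (by omega), Option.ne_none_iff_exists'.1 h1⟩

/-- All correct processes eventually reach every height. -/
lemma exists_reached (e : Execution sys faulty GST Δ)
    (hf : ∑ p ∈ faulty, sys.power p ≤ par.f) (hΔ : 0 < Δ) :
    ∀ {h : ℕ}, (h : ℕ∞) < sys.heights →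
      ∃ T, GST ≤ T ∧ ∀ p ∉ faulty, (e.snap T p).Past h 0 0
  | 0, _ => by
    have hstart : ∀ p, ∃ k, p ∉ faulty → (e.state k p).started = true := fun p => by
      by_cases hp : p ∈ faulty
      · exact ⟨0, fun h => absurd hp h⟩
      · exact (e.starts p hp).imp fun k hk _ => hk
    choose k hk using hstart
    refine ⟨max GST (e.time (Finset.univ.sup k)), le_max_left _ _, fun p hp => ?_⟩
    have h1 : Finset.univ.sup k < e.idx (max GST (e.time (Finset.univ.sup k))) :=
      lt_idx.2 (le_max_right _ _)
    have h2 : k p ≤ Finset.univ.sup k := Finset.le_sup (Finset.mem_univ p)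
    exact ⟨started_mono (h2.trans h1.le) (hk p hp), by omega⟩
  | h + 1, hh => by
    have hh' : (h : ℕ∞) < sys.heights := lt_trans (by exact_mod_cast Nat.lt_succ_self h) hh
    obtain ⟨T, hT, hreached⟩ := exists_reached e hf hΔ hh'
    -- Finitely many processes have a largest current round, so the quantitative bound applies at
    -- any height reached by all.
    let r₀ := Finset.univ.sup fun p => (e.snap T p).round
    have hB := par.decisionBound_pos hΔ r₀
    refine ⟨T + par.decisionBound Δ r₀ + Δ, by linarith, fun p hp => ?_⟩
    have h1 := height_lt_of_bound hf hΔ hh' hT hreached (r₀ := r₀)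
      (fun p _ _ => Finset.le_sup (f := fun p => (e.snap T p).round) (Finset.mem_univ p)) hp
    exact ⟨started_mono (idx_mono (by linarith)) (hreached p hp).1, by omega⟩

end Execution

end Tendermint

theorem lemma7 (par : Tendermint.Params) (Δ : ℝ) (hΔ : 0 < Δ) :
    ∃ B : ℕ → ℝ,
      ∀ (P V I : Type*) [Fintype P]
        (sys : Tendermint.System par P V I) (faulty : Finset P)
        (_hfaulty : ∑ p ∈ faulty, sys.power p ≤ par.f)
        (GST : ℝ) (e : Tendermint.Execution sys faulty GST Δ)
        (h : ℕ) (_hh : (h : ℕ∞) < sys.heights),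
        (∀ p ∉ faulty, ∃ T : ℝ, e.DecidedBy p h T) ∧
        (∀ (T : ℝ) (r₀ : ℕ), GST ≤ T →
          (∀ p ∉ faulty, e.ReachedHeight p h T) →
          (∀ p ∉ faulty, ∀ r, e.StartedRound p h r T → r ≤ r₀) →
          ∀ p ∉ faulty, e.DecidedBy p h (T + B r₀)) := by
  -- The extra `Δ` is for spreading the first decision.
  refine ⟨fun r₀ => par.decisionBound Δ r₀ + Δ, ?_⟩
  intro P V I _ sys faulty hf GST e h hh
  refine ⟨fun p hp => ?_, fun T r₀ hT hreached hround p hp => ?_⟩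
  · obtain ⟨T, hT, hreached⟩ := e.exists_reached hf hΔ hh
    exact ⟨_, Tendermint.Execution.decidedBy_of_height_lt
      (Tendermint.Execution.height_lt_of_bound hf hΔ hh hT hreached
        (r₀ := Finset.univ.sup fun p => (e.snap T p).round)
        (fun p _ _ => Finset.le_sup (f := fun p => (e.snap T p).round) (Finset.mem_univ p)) hp)⟩
  · have hpast : ∀ p ∉ faulty, (e.snap T p).Past h 0 0 := fun p hp => by
      obtain ⟨k, hk, hs, hle⟩ := hreached p hp
      exact Tendermint.Execution.past_mono (Tendermint.Execution.lt_idx.2 hk)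
        (show (e.state (k + 1) p).Past h 0 0 from ⟨hs, by omega⟩)
    rw [← add_assoc]
    refine Tendermint.Execution.decidedBy_of_height_lt
      (Tendermint.Execution.height_lt_of_bound hf hΔ hh hT hpast (fun q hq hqh => ?_) hp)
    -- The snapshot at `T` is the state right after an event at a time at most `T`, so its round
    -- counts as started by `T` and is at most `r₀`.
    obtain ⟨k, hk, -⟩ := Tendermint.Execution.idx_pos_of_started (hpast q hq).1
    refine hround q hq _ ⟨k, Tendermint.Execution.lt_idx.1 (by omega), ?_⟩
    rw [← hk]
    exact ⟨(hpast q hq).1, hqh, rfl⟩
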